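/- **Tower-Set** is the category whose objects are the inverse sequences $\underline X=(X_n,p_n)_{n\in\mathbb N}$ of (small) sets, with bonding maps $p_{nm}:X_m\to X_n$ for $n\le m$. A morphism of sequences $(f_n,\Phi):(X_n,p_n)\to(Y_n,q_n)$ consists of a function $\Phi:\mathbb N\to\mathbb N$ and maps $f_n:X_{\Phi(n)}\to Y_n$ such that for all $n<n'$ there is $m\ge\Phi(n),\Phi(n')$ with $f_n\circ p_{\Phi(n)m}=q_{nn'}\circ f_{n'}\circ p_{\Phi(n')m}$. Two such morphisms $(f_n,\Phi)$, $(g_n,\Psi)$ are equivalent if for every $n$ there is $m\ge\Phi(n),\Psi(n)$ with $f_n\circ p_{\Phi(n)m}=g_n\circ p_{\Psi(n)m}$. The morphisms of **Tower-Set** are the equivalence classes; the composite of the classes of $(f_n,\Phi)$ and $(g_n,\Psi)$ is the class of $(g_n\circ f_{\Psi(n)},\Phi\circ\Psi)$. A rooted simplicial tree $(T,v)$ is the geometric realization $T$ of a (small, not necessarily locally finite) tree in the sense of graph theory, with the length metric in which every edge has length $1$, together with a chosen vertex $v$, the root. A map $f:(T,v)\to(T',w)$ is rooted if $f(v)=w$,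 metrically proper if preimages of bounded sets are bounded, and non-expansive if $d(f(x),f(y))\le d(x,y)$ for all $x,y\in T$. Two rooted metrically proper non-expansive maps $f,g:(T,v)\to(T',w)$ are rooted metrically proper non-expansive homotopic if there is a continuous map $H:T\times[0,1]\to T'$ with $H(\cdot,0)=f$, $H(\cdot,1)=g$ and $H(v,t)=w$ for all $t$, such that for every $M>0$ there is $N>0$ with $H^{-1}(B(w,M))\subset B(v,N)\times[0,1]$, and such that $H(\cdot,t)$ is non-expansive for every $t\in[0,1]$. **Corollary.** There is an equivalence of categories between **Tower-Set** and the category whose objects are the rooted simplicial trees and whose morphisms are the rooted metrically proper non-expansive homotopy classes of rooted metrically proper non-expansive maps. -/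

import Mathlib

open CategoryTheory

universe v u

/-! ### The category of inverse sequences of a category -/

/-- An inverse sequence in `C`: an inverse system in `C` indexed by the natural numbers. -/
structure Tower (C : Type u) [Category.{v} C] where
  /-- the underlying inverse system -/
  sys : ℕᵒᵖ ⥤ C

namespace Tower

variable {C : Type u} [Category.{v} C]

/-- The `n`-th term `X_n`. -/
def term (X : Tower C) (n : ℕ) : C := X.sys.obj (Opposite.op n)

/-- The bonding morphism `p_{nm} : X_m ⟶ X_n` for `n ≤ m`. -/
def bond (X : Tower C) {n m : ℕ} (h : n ≤ m) : X.term m ⟶ X.term n :=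
  X.sys.map (homOfLE h).op

@[simp] lemma bond_refl (X : Tower C) (n : ℕ) : X.bond (le_refl n) = 𝟙 (X.term n) :=
  X.sys.map_id _

@[simp] lemma bond_bond (X : Tower C) {n m k : ℕ} (h : n ≤ m) (h' : m ≤ k) :
    X.bond h' ≫ X.bond h = X.bond (h.trans h') :=
  (X.sys.map_comp _ _).symm

@[simp] lemma bond_bond_assoc (X : Tower C) {n m k : ℕ} (h : n ≤ m) (h' : m ≤ k) {Z : C}
    (g : X.term n ⟶ Z) : X.bond h' ≫ X.bond h ≫ g = X.bond (h.trans h') ≫ g := by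
  rw [← Category.assoc, bond_bond]

/-- A morphism of inverse sequences `(f_n, Φ)`: an index function `Φ` and morphisms
`f_n : X_{Φ(n)} ⟶ Y_n` that are compatible with the bonding morphisms at some later stage. -/
structure PreHom (X Y : Tower C) where
  /-- the index function `Φ` -/
  idx : ℕ → ℕ
  /-- the morphisms `f_n` -/
  app : ∀ n, X.term (idx n) ⟶ Y.term n
  compat : ∀ n n' (h : n < n'), ∃ m, ∃ (h₁ : idx n ≤ m) (h₂ : idx n' ≤ m),
    X.bond h₁ ≫ app n = X.bond h₂ ≫ app n' ≫ Y.bond h.le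

/-- `(f_n, Φ) ∼ (g_n, Ψ)` if for every `n`, `f_n` and `g_n` agree on some later `X_m`. -/
def PreHom.Equiv {X Y : Tower C} (f g : PreHom X Y) : Prop :=
  ∀ n, ∃ m, ∃ (h₁ : f.idx n ≤ m) (h₂ : g.idx n ≤ m), X.bond h₁ ≫ f.app n = X.bond h₂ ≫ g.app n

lemma bond_eq_mono (X : Tower C) {a b m m' : ℕ} {Z : C} {f : X.term a ⟶ Z} {g : X.term b ⟶ Z}
    (h₁ : a ≤ m) (h₂ : b ≤ m) (e : X.bond h₁ ≫ f = X.bond h₂ ≫ g) (h : m ≤ m') :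
    X.bond (h₁.trans h) ≫ f = X.bond (h₂.trans h) ≫ g := by
  rw [← bond_bond_assoc X h₁ h, e, bond_bond_assoc]

lemma PreHom.compat_le {X Y : Tower C} (f : PreHom X Y) {n n' : ℕ} (h : n ≤ n') :
    ∃ m, ∃ (h₁ : f.idx n ≤ m) (h₂ : f.idx n' ≤ m),
      X.bond h₁ ≫ f.app n = X.bond h₂ ≫ f.app n' ≫ Y.bond h := by
  rcases h.lt_or_eq with h | rfl
  · exact f.compat n n' h
  · exact ⟨f.idx n, le_refl _, le_refl _, by simp⟩

lemma PreHom.equivalence (X Y : Tower C) : Equivalence (PreHom.Equiv (X := X) (Y := Y)) where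
  refl f n := ⟨f.idx n, le_refl _, le_refl _, rfl⟩
  symm h n := by
    obtain ⟨m, h₁, h₂, e⟩ := h n
    exact ⟨m, h₂, h₁, e.symm⟩
  trans h h' n := by
    obtain ⟨m, h₁, h₂, e⟩ := h n
    obtain ⟨m', h₁', h₂', e'⟩ := h' n
    exact ⟨max m m', h₁.trans (le_max_left _ _), h₂'.trans (le_max_right _ _),
      (bond_eq_mono X h₁ h₂ e (le_max_left _ _)).trans
        (bond_eq_mono X h₁' h₂' e' (le_max_right _ _))⟩

instance PreHom.setoid (X Y : Tower C) : Setoid (PreHom X Y) := ⟨_, PreHom.equivalence X Y⟩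

/-- The identity morphism of sequences. -/
def PreHom.id (X : Tower C) : PreHom X X where
  idx n := n
  app n := 𝟙 _
  compat n n' h := ⟨n', h.le, le_refl _, by simp⟩

/-- The composite of `(f_n, Φ)` and `(g_n, Ψ)` is `(g_n ∘ f_{Ψ(n)}, Φ ∘ Ψ)`. -/
def PreHom.comp {X Y Z : Tower C} (f : PreHom X Y) (g : PreHom Y Z) : PreHom X Z where
  idx n := f.idx (g.idx n)
  app n := f.app (g.idx n) ≫ g.app n
  compat n n' h := by
    obtain ⟨k, h₁, h₂, e⟩ := g.compat n n' h
    obtain ⟨m, i₁, i₂, e₁⟩ := f.compat_le h₁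
    obtain ⟨m', j₁, j₂, e₂⟩ := f.compat_le h₂
    have l := le_max_left m m'
    have r := le_max_right m m'
    refine ⟨max m m', i₁.trans l, j₁.trans r, ?_⟩
    have e₁' := bond_eq_mono X i₁ i₂ e₁ l
    have e₂' := bond_eq_mono X j₁ j₂ e₂ r
    calc X.bond (i₁.trans l) ≫ f.app (g.idx n) ≫ g.app n
        = (X.bond (i₁.trans l) ≫ f.app (g.idx n)) ≫ g.app n := by simp
      _ = X.bond (i₂.trans l) ≫ f.app k ≫ Y.bond h₁ ≫ g.app n := by rw [e₁']; simp
      _ = (X.bond (j₂.trans r) ≫ f.app k ≫ Y.bond h₂) ≫ g.app n' ≫ Z.bond h.le := by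
          rw [e]; simp
      _ = _ := by rw [← e₂']; simp

lemma PreHom.comp_equiv {X Y Z : Tower C} {f f' : PreHom X Y} {g g' : PreHom Y Z}
    (hf : f.Equiv f') (hg : g.Equiv g') : (f.comp g).Equiv (f'.comp g') := by
  intro n
  obtain ⟨k, h₁, h₂, e⟩ := hg n
  obtain ⟨a, a₁, a₂, ea⟩ := f.compat_le h₁
  obtain ⟨b, b₁, b₂, eb⟩ := f'.compat_le h₂
  obtain ⟨c, c₁, c₂, ec⟩ := hf k
  have la : a ≤ max a (max b c) := le_max_left _ _
  have lb : b ≤ max a (max b c) := (le_max_left _ _).trans (le_max_right _ _)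
  have lc : c ≤ max a (max b c) := (le_max_right _ _).trans (le_max_right _ _)
  refine ⟨max a (max b c), a₁.trans la, b₁.trans lb, ?_⟩
  have ea' := bond_eq_mono X a₁ a₂ ea la
  have eb' := bond_eq_mono X b₁ b₂ eb lb
  have ec' := bond_eq_mono X c₁ c₂ ec lc
  calc X.bond (a₁.trans la) ≫ f.app (g.idx n) ≫ g.app n
      = (X.bond (a₁.trans la) ≫ f.app (g.idx n)) ≫ g.app n := by simp
    _ = (X.bond (c₁.trans lc) ≫ f.app k) ≫ Y.bond h₁ ≫ g.app n := by rw [ea']; simp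
    _ = (X.bond (b₂.trans lb) ≫ f'.app k ≫ Y.bond h₂) ≫ g'.app n := by rw [ec', e]; simp
    _ = X.bond (b₁.trans lb) ≫ f'.app (g'.idx n) ≫ g'.app n := by rw [← eb']; simp

/-- `Tower-C`: inverse sequences in `C` and equivalence classes of morphisms of sequences. -/
instance category : Category (Tower C) where
  Hom X Y := Quotient (PreHom.setoid X Y)
  id X := ⟦PreHom.id X⟧
  comp := Quotient.map₂ PreHom.comp fun _ _ hf _ _ hg => PreHom.comp_equiv hf hg
  id_comp := by
    rintro X Y ⟨f⟩
    exact Quotient.sound fun n => ⟨f.idx n, le_refl _, le_refl _, by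
      simp [PreHom.comp, PreHom.id]⟩
  comp_id := by
    rintro X Y ⟨f⟩
    exact Quotient.sound fun n => ⟨f.idx n, le_refl _, le_refl _, by
      simp [PreHom.comp, PreHom.id]⟩
  assoc := by
    rintro X Y Z W ⟨f⟩ ⟨g⟩ ⟨h⟩
    exact Quotient.sound fun n => ⟨f.idx (g.idx (h.idx n)), le_refl _, le_refl _, by
      simp [PreHom.comp]⟩

end Tower

/-- `Tower-Set`. -/
abbrev TowerSet : Type (u + 1) := Tower (Type u)

/-! ### The geometric realization of a graph, with edges of length one -/

namespace SimpleGraph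

variable {V : Type u} (G : SimpleGraph V)

/-- The closed edge spanned by `a` and `b`, in barycentric coordinates. -/
def closedEdge (a b : V) : Set (V →₀ ℝ) :=
  segment ℝ (Finsupp.single a 1) (Finsupp.single b 1)

/-- The geometric realization of `G` as a one-dimensional simplicial complex: its points are the
barycentric coordinates of points of vertices (the case `a = b`) and of closed edges. -/
def Realization : Type u :=
  {x : V →₀ ℝ // ∃ a b, (a = b ∨ G.Adj a b) ∧ x ∈ closedEdge a b}

variable {G}

/-- A vertex of `G` as a point of the realization. -/
noncomputable def Realization.vertex (a : V) : G.Realization :=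
  ⟨Finsupp.single a 1, a, a, Or.inl rfl, left_mem_segment ℝ _ _⟩

/-- `PathLength x y l`: there is a polygonal path from `x` to `y` of length `l`, that is, a finite
chain from `x` to `y` in which consecutive points `p`, `q` lie on a common closed edge and
contribute their distance along this edge, which is parametrized by `[0, 1]`. -/
inductive PathLength : G.Realization → G.Realization → ℝ → Prop
  | refl (x : G.Realization) : PathLength x x 0
  | step {x y z : G.Realization} {a b : V} {l : ℝ} (hab : G.Adj a b)
      (hx : x.1 ∈ closedEdge a b) (hy : y.1 ∈ closedEdge a b) (h : PathLength y z l) :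
      PathLength x z (|x.1 a - y.1 a| + l)

lemma closedEdge_apply {a b : V} (hab : a ≠ b) {x : V →₀ ℝ} (hx : x ∈ closedEdge a b) :
    x b = 1 - x a ∧ ∀ c, c ≠ a → c ≠ b → x c = 0 := by
  classical
  obtain ⟨s, t, _, _, hst, rfl⟩ := hx
  refine ⟨?_, fun c ha hb => ?_⟩
  · simp [hab, hab.symm]
    linarith
  · simp [ha.symm, hb.symm]

lemma closedEdge_abs_le {a b : V} (hab : a ≠ b) {x y : V →₀ ℝ} (hx : x ∈ closedEdge a b)
    (hy : y ∈ closedEdge a b) (c : V) : |x c - y c| ≤ |x a - y a| := by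
  obtain ⟨hx1, hx2⟩ := closedEdge_apply hab hx
  obtain ⟨hy1, hy2⟩ := closedEdge_apply hab hy
  by_cases ha : c = a
  · rw [ha]
  by_cases hb : c = b
  · rw [hb, hx1, hy1, show 1 - x a - (1 - y a) = -(x a - y a) by ring, abs_neg]
  · rw [hx2 c ha hb, hy2 c ha hb]
    simp

namespace PathLength

lemma nonneg {x y : G.Realization} {l : ℝ} (h : PathLength x y l) : 0 ≤ l := by
  induction h with
  | refl => exact le_rfl
  | step _ _ _ _ ih => positivity

lemma trans {x y z : G.Realization} {l l' : ℝ} (h : PathLength x y l) (h' : PathLength y z l') :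
    PathLength x z (l + l') := by
  induction h with
  | refl => simpa using h'
  | step hab hx hy _ ih =>
    rw [add_assoc]
    exact step hab hx hy (ih h')

lemma symm {x y : G.Realization} {l : ℝ} (h : PathLength x y l) : PathLength y x l := by
  induction h with
  | refl x => exact refl x
  | step hab hx hy _ ih =>
    have := ih.trans (step hab hy hx (refl _))
    rwa [add_zero, add_comm, abs_sub_comm] at this

lemma coord_le {x y : G.Realization} {l : ℝ} (h : PathLength x y l) (c : V) :
    |x.1 c - y.1 c| ≤ l := by
  induction h with
  | refl => simp
  | step hab hx hy _ ih =>
    exact (abs_sub_le _ _ _).trans (add_le_add (closedEdge_abs_le hab.ne hx hy c) ih)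

lemma exists_vertex (x : G.Realization) : ∃ a l, PathLength x (Realization.vertex a) l := by
  obtain ⟨x, a, b, h | h, hx⟩ := x
  · subst h
    have hx' : x = Finsupp.single a 1 := by simpa [closedEdge] using hx
    subst hx'
    exact ⟨a, 0, refl _⟩
  · exact ⟨a, _, step h hx (left_mem_segment ℝ _ _) (refl _)⟩

lemma exists_of_reachable {a b : V} (h : G.Reachable a b) :
    ∃ l, PathLength (G := G) (Realization.vertex a) (Realization.vertex b) l := by
  obtain ⟨w⟩ := h
  induction w with
  | nil => exact ⟨0, refl _⟩
  | cons hab _ ih =>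
    obtain ⟨l, hl⟩ := ih
    exact ⟨_, step hab (left_mem_segment ℝ _ _) (right_mem_segment ℝ _ _) hl⟩

lemma exists_of_connected (hG : G.Connected) (x y : G.Realization) : ∃ l, PathLength x y l := by
  obtain ⟨a, _, ha⟩ := exists_vertex x
  obtain ⟨b, _, hb⟩ := exists_vertex y
  obtain ⟨_, h⟩ := exists_of_reachable (hG.preconnected a b)
  exact ⟨_, (ha.trans h).trans hb.symm⟩

end PathLength

/-- The length metric: the infimum of the lengths of the paths from `x` to `y`. -/
noncomputable def pathDist (x y : G.Realization) : ℝ := sInf {l | PathLength x y l}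

lemma pathDist_le {x y : G.Realization} {l : ℝ} (h : PathLength x y l) : pathDist x y ≤ l :=
  csInf_le ⟨0, fun _ h => h.nonneg⟩ h

/-- The realization of a connected graph is a metric space under the length metric. -/
@[reducible] noncomputable def Realization.metricSpace (hG : G.Connected) :
    MetricSpace G.Realization where
  dist := pathDist
  dist_self x := le_antisymm (pathDist_le (.refl x)) (Real.sInf_nonneg fun _ h => h.nonneg)
  dist_comm x y := by
    unfold pathDist
    congr 1
    ext l
    exact ⟨fun h => h.symm, fun h => h.symm⟩
  dist_triangle x y z := by
    have hxy := PathLength.exists_of_connected hG x y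
    have hyz := PathLength.exists_of_connected hG y z
    refine le_of_forall_pos_le_add fun ε hε => ?_
    obtain ⟨l, hl, hl'⟩ := exists_lt_of_csInf_lt hxy
      (show sInf {l | PathLength x y l} < pathDist x y + ε / 2 from
        lt_add_of_pos_right _ (half_pos hε))
    obtain ⟨k, hk, hk'⟩ := exists_lt_of_csInf_lt hyz
      (show sInf {l | PathLength y z l} < pathDist y z + ε / 2 from
        lt_add_of_pos_right _ (half_pos hε))
    have := pathDist_le (PathLength.trans hl hk)
    linarith
  eq_of_dist_eq_zero := by
    intro x y h
    refine Subtype.ext (Finsupp.ext fun c => ?_)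
    have h' : |x.1 c - y.1 c| ≤ pathDist x y :=
      le_csInf (PathLength.exists_of_connected hG x y) fun l hl => hl.coord_le c
    change pathDist x y = 0 at h
    rw [h] at h'
    exact sub_eq_zero.1 (abs_nonpos_iff.1 h')

end SimpleGraph

/-! ### Rooted simplicial trees and their non-expansive maps -/

/-- A rooted simplicial tree: a tree (in the sense of graphs) with a chosen vertex. -/
structure RootedSimplicialTree : Type (u + 1) where
  /-- the vertices -/
  V : Type u
  /-- the edges -/
  graph : SimpleGraph V
  isTree : graph.IsTree
  /-- the root vertex -/
  rootVertex : V

namespace RootedSimplicialTree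

/-- The metric space underlying a rooted simplicial tree: its geometric realization, with edges
of length one. -/
def Space (T : RootedSimplicialTree.{u}) : Type u := T.graph.Realization

noncomputable instance (T : RootedSimplicialTree.{u}) : MetricSpace T.Space :=
  SimpleGraph.Realization.metricSpace T.isTree.connected

/-- The root, as a point of the realization. -/
noncomputable def root (T : RootedSimplicialTree.{u}) : T.Space := SimpleGraph.Realization.vertex T.rootVertex

/-- A map between metric spaces is metrically proper if preimages of bounded sets are bounded. -/
def MetricallyProper {X Y : Type*} [MetricSpace X] [MetricSpace Y] (f : X → Y) : Prop :=
  ∀ A : Set Y, Bornology.IsBounded A → Bornology.IsBounded (f ⁻¹' A)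

/-- A rooted metrically proper non-expansive map between rooted simplicial trees. -/
structure NEMap (S T : RootedSimplicialTree.{u}) where
  /-- the underlying map of the realizations -/
  toFun : S.Space → T.Space
  map_root : toFun S.root = T.root
  proper : MetricallyProper toFun
  nonexpansive : LipschitzWith 1 toFun

/-- The underlying continuous map. -/
def NEMap.toCont {S T : RootedSimplicialTree.{u}} (f : NEMap S T) : C(S.Space, T.Space) :=
  ⟨f.toFun, f.nonexpansive.continuous⟩

/-- `f ≃_L g`: there is a rooted metrically proper homotopy from `f` to `g` which is non-expansive
at each level. -/
def NEMap.Homotopic {S T : RootedSimplicialTree.{u}} (f g : NEMap S T) : Prop :=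
  ∃ H : ContinuousMap.Homotopy f.toCont g.toCont,
    (∀ t, H (t, S.root) = T.root) ∧
    (∀ M > 0, ∃ N > 0, ∀ t x, H (t, x) ∈ Metric.ball T.root M → x ∈ Metric.ball S.root N) ∧
    ∀ t, LipschitzWith 1 fun x => H (t, x)

namespace NEMap

variable {S T U : RootedSimplicialTree.{u}}

lemma ball_proper (f : NEMap S T) (M : ℝ) :
    ∃ N > 0, ∀ x, f.toFun x ∈ Metric.ball T.root M → x ∈ Metric.ball S.root N := by
  obtain ⟨r, hr⟩ := (f.proper (Metric.ball T.root M) Metric.isBounded_ball).subset_ball S.root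
  exact ⟨max r 1, by positivity, fun x hx => Metric.ball_subset_ball (le_max_left _ _) (hr hx)⟩

lemma equivalence (S T : RootedSimplicialTree.{u}) :
    Equivalence (Homotopic (S := S) (T := T)) where
  refl f := by
    refine ⟨ContinuousMap.Homotopy.refl _, fun _ => f.map_root, fun M _ => ?_,
      fun _ => f.nonexpansive⟩
    obtain ⟨N, hN, h⟩ := f.ball_proper M
    exact ⟨N, hN, fun _ => h⟩
  symm := by
    rintro f g ⟨H, h1, h2, h3⟩
    refine ⟨H.symm, fun t => h1 (unitInterval.symm t), fun M hM => ?_,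
      fun t => h3 (unitInterval.symm t)⟩
    obtain ⟨N, hN, h⟩ := h2 M hM
    exact ⟨N, hN, fun t => h (unitInterval.symm t)⟩
  trans := by
    rintro f g k ⟨H, h1, h2, h3⟩ ⟨K, k1, k2, k3⟩
    have key : ∀ t, (∃ s, ∀ x, H.trans K (t, x) = H (s, x)) ∨
        ∃ s, ∀ x, H.trans K (t, x) = K (s, x) := by
      intro t
      by_cases ht : (t : ℝ) ≤ 1 / 2
      · left
        exact ⟨⟨2 * t, (unitInterval.mul_pos_mem_iff zero_lt_two).2 ⟨t.2.1, ht⟩⟩, fun x => by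
          rw [ContinuousMap.Homotopy.trans_apply, dif_pos ht]⟩
      · right
        exact ⟨⟨2 * t - 1, unitInterval.two_mul_sub_one_mem_iff.2 ⟨(not_le.1 ht).le, t.2.2⟩⟩,
          fun x => by rw [ContinuousMap.Homotopy.trans_apply, dif_neg ht]⟩
    refine ⟨H.trans K, fun t => ?_, fun M hM => ?_, fun t => ?_⟩
    · obtain ⟨s, hs⟩ | ⟨s, hs⟩ := key t
      · rw [hs, h1]
      · rw [hs, k1]
    · obtain ⟨N, hN, h⟩ := h2 M hM
      obtain ⟨N', _, h'⟩ := k2 M hM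
      refine ⟨max N N', lt_max_of_lt_left hN, fun t x hx => ?_⟩
      obtain ⟨s, hs⟩ | ⟨s, hs⟩ := key t
      · rw [hs] at hx
        exact Metric.ball_subset_ball (le_max_left _ _) (h s x hx)
      · rw [hs] at hx
        exact Metric.ball_subset_ball (le_max_right _ _) (h' s x hx)
    · obtain ⟨s, hs⟩ | ⟨s, hs⟩ := key t
      · simpa only [hs] using h3 s
      · simpa only [hs] using k3 s

instance setoid (S T : RootedSimplicialTree.{u}) : Setoid (NEMap S T) := ⟨_, equivalence S T⟩

/-- The identity map. -/
def id (T : RootedSimplicialTree.{u}) : NEMap T T where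
  toFun x := x
  map_root := rfl
  proper _ hA := hA
  nonexpansive := LipschitzWith.id

/-- The composite `g ∘ f`. -/
def comp (f : NEMap S T) (g : NEMap T U) : NEMap S U where
  toFun x := g.toFun (f.toFun x)
  map_root := by rw [f.map_root, g.map_root]
  proper A hA := f.proper _ (g.proper A hA)
  nonexpansive := by
    have := g.nonexpansive.comp f.nonexpansive
    rw [one_mul] at this
    exact this

lemma comp_homotopic {f f' : NEMap S T} {g g' : NEMap T U} (hf : f.Homotopic f')
    (hg : g.Homotopic g') : (f.comp g).Homotopic (f'.comp g') := by
  obtain ⟨H, h1, h2, h3⟩ := hf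
  obtain ⟨K, k1, k2, k3⟩ := hg
  refine ⟨⟨⟨fun p => K (p.1, H p), by fun_prop⟩, fun x => ?_, fun x => ?_⟩,
    fun t => ?_, fun M hM => ?_, fun t => ?_⟩
  · exact (K.apply_zero _).trans (congrArg g.toFun (H.apply_zero x))
  · exact (K.apply_one _).trans (congrArg g'.toFun (H.apply_one x))
  · exact (congrArg (fun y => K (t, y)) (h1 t)).trans (k1 t)
  · obtain ⟨N, hN, h⟩ := k2 M hM
    obtain ⟨N', hN', h'⟩ := h2 N hN
    exact ⟨N', hN', fun t x hx => h' t x (h t _ hx)⟩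
  · have := (k3 t).comp (h3 t)
    rw [one_mul] at this
    exact this

end NEMap

/-- Rooted simplicial trees with rooted metrically proper non-expansive homotopy classes of rooted
metrically proper non-expansive maps. -/
instance category : Category RootedSimplicialTree.{u} where
  Hom S T := Quotient (NEMap.setoid S T)
  id T := ⟦NEMap.id T⟧
  comp := Quotient.map₂ NEMap.comp fun _ _ hf _ _ hg => NEMap.comp_homotopic hf hg
  id_comp := by
    rintro S T ⟨f⟩
    rfl
  comp_id := by
    rintro S T ⟨f⟩
    rfl
  assoc := by
    rintro S T U W ⟨f⟩ ⟨g⟩ ⟨h⟩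
    rfl

end RootedSimplicialTree

/-! A rooted tree is sent to the inverse sequence of its spheres of integral radius around the root,
with bonding maps that move points towards the root. This `sphereFunctor` is faithful, full and
essentially surjective.

All the geometry is read off the Gromov product `gp` at the root. It is ultrametric, it determines
distances, and `s ≤ gp x y` says that `x` and `y` have the same ancestor at height `s`
(`anc_eq_anc_iff`). A path that stays above height `s` cannot change its ancestor at height `s`
(`le_gp_of_path`). Applied to the image of a segment under a proper map `f`, this shows that the
ancestor of `f x` at height `n` depends only on an ancestor of `x` far from the root
(`IsModulus.anc_eq`), so `f` induces a morphism of sequences.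

Faithfulness: applied to the track of a point under a proper homotopy, the same principle shows that
homotopic maps are `Close`. Conversely, two close maps both slide down to their pointwise meet, and
hyperbolicity keeps every stage non-expansive (`Close.homotopic_meet`). Closeness is exactly
equivalence of the induced morphisms of sequences (`preHom_equiv_iff`).

Fullness: a morphism of sequences may use very sparse radii. The image of `x` is therefore placed at
height `slowGrowth` of the height of `x`, an unbounded 1-Lipschitz function growing so slowly that
the morphism already determines the point at that height (`CoherentFamily.toNEMap`).

Essential surjectivity: the members of `X_n` become the vertices of depth `n + 1` of a tree whose
edges are given by the bonding maps. Its spheres return the sequence shifted by one, and the shift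
is an isomorphism of towers. -/

/-! ### Rooted real trees -/

/-- The Gromov product of `x` and `y` based at `o`. -/
noncomputable def gromovProduct {X : Type*} [MetricSpace X] (o x y : X) : ℝ :=
  (dist o x + dist o y - dist x y) / 2

/-- A rooted real tree: a `0`-hyperbolic pointed metric space in which every `x` is joined to the
root by a segment, whose point at distance `s` from the root is `anc s x`. -/
class RootedRTree (X : Type*) [MetricSpace X] where
  /-- the root -/
  base : X
  /-- the point at distance `s` from the root on the segment from the root to `x` -/
  anc : ℝ → X → X
  gromovProduct_anc : ∀ s, 0 ≤ s → ∀ x y,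
    gromovProduct base (anc s x) y = min s (gromovProduct base x y)
  hyperbolic : ∀ x y z,
    min (gromovProduct base x y) (gromovProduct base y z) ≤ gromovProduct base x z

namespace RootedRTree

section Basic

variable {X : Type*} [MetricSpace X] [RootedRTree X]

/-- The distance from the root. -/
noncomputable def lvl (x : X) : ℝ := dist (base : X) x

/-- The distance from the root at which the segments to `x` and `y` branch. -/
noncomputable def gp (x y : X) : ℝ := gromovProduct base x y

lemma dist_eq (x y : X) : dist x y = lvl x + lvl y - 2 * gp x y := by
  unfold lvl gp gromovProduct; ring

lemma gp_comm (x y : X) : gp x y = gp y x := by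
  unfold gp gromovProduct; rw [dist_comm x y]; ring

@[simp] lemma gp_self (x : X) : gp x x = lvl x := by
  unfold gp gromovProduct lvl; rw [dist_self]; ring

lemma gp_le_left (x y : X) : gp x y ≤ lvl x := by
  have := dist_triangle (base : X) x y
  unfold gp gromovProduct lvl; linarith

lemma gp_le_right (x y : X) : gp x y ≤ lvl y := gp_comm x y ▸ gp_le_left y x

lemma gp_nonneg (x y : X) : 0 ≤ gp x y := by
  have := dist_triangle_left x y (base : X)
  unfold gp gromovProduct; linarith

lemma lvl_nonneg (x : X) : 0 ≤ lvl x := dist_nonneg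

@[simp] lemma lvl_base : lvl (base : X) = 0 := dist_self _

lemma eq_base {x : X} (h : lvl x = 0) : x = base := (dist_eq_zero.1 h).symm

/-- Hyperbolicity makes `s ≤ gp x y` an equivalence relation on the points of height at least `s`;
its classes are the branches at height `s`. -/
lemma le_gp_trans {x y z : X} {s : ℝ} (h : s ≤ gp x y) (h' : s ≤ gp y z) : s ≤ gp x z :=
  (le_min h h').trans (hyperbolic x y z)

lemma lvl_sub_le (x y : X) : |lvl x - lvl y| ≤ dist x y := by
  rw [dist_eq, abs_le]
  constructor <;> linarith [gp_le_left x y, gp_le_right x y]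

lemma gp_anc {s : ℝ} (hs : 0 ≤ s) (x y : X) : gp (anc s x) y = min s (gp x y) :=
  gromovProduct_anc s hs x y

lemma gp_anc_anc {s t : ℝ} (hs : 0 ≤ s) (ht : 0 ≤ t) (x y : X) :
    gp (anc s x) (anc t y) = min s (min t (gp x y)) := by
  rw [gp_anc hs, gp_comm, gp_anc ht, gp_comm]

lemma lvl_anc {s : ℝ} (hs : 0 ≤ s) (x : X) : lvl (anc s x) = min s (lvl x) := by
  rw [← gp_self, gp_anc_anc hs hs, gp_self, ← min_assoc, min_self]

lemma lvl_anc_of_le {s : ℝ} (hs : 0 ≤ s) {x : X} (h : s ≤ lvl x) : lvl (anc s x) = s := by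
  rw [lvl_anc hs, min_eq_left h]

/-- The points of the segment from the root to `x` are determined by their distance to the root. -/
lemma eq_anc {z x : X} {s : ℝ} (hs : lvl z = min s (lvl x)) (h : gp z x = lvl z) : z = anc s x := by
  rcases le_or_gt 0 s with h0 | h0
  · rw [← dist_eq_zero, dist_eq, lvl_anc h0, gp_comm, gp_anc h0, gp_comm, h, hs]
    rcases min_cases s (lvl x) with h' | h' <;> rw [h'.1]
    · simp; ring
    · rw [min_eq_right h'.2.le]; ring
  · rw [min_eq_left (h0.le.trans (lvl_nonneg x))] at hs
    linarith [lvl_nonneg z]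

lemma anc_eq_anc_iff {s : ℝ} (hs : 0 ≤ s) {x y : X} (hx : s ≤ lvl x) (hy : s ≤ lvl y) :
    anc s x = anc s y ↔ s ≤ gp x y := by
  rw [← dist_eq_zero, dist_eq, lvl_anc_of_le hs hx, lvl_anc_of_le hs hy, gp_anc_anc hs hs,
    ← min_assoc, min_self]
  constructor
  · intro h
    exact (by linarith : s = min s (gp x y)).le.trans (min_le_right _ _)
  · intro h
    rw [min_eq_left h]; ring

lemma anc_of_lvl_le {s : ℝ} {x : X} (h : lvl x ≤ s) : anc s x = x :=
  (eq_anc (by rw [min_eq_right h]) (gp_self x)).symm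

lemma gp_anc_self {s : ℝ} (hs : 0 ≤ s) (x : X) : gp (anc s x) x = min s (lvl x) := by
  rw [gp_anc hs, gp_self]

lemma anc_anc {s t : ℝ} (hs : 0 ≤ s) (ht : 0 ≤ t) (x : X) :
    anc s (anc t x) = anc (min s t) x := by
  apply eq_anc
  · rw [lvl_anc hs, lvl_anc ht, min_assoc]
  · rw [gp_anc hs, lvl_anc hs, gp_anc_self ht, lvl_anc ht]

lemma anc_anc_of_le {s t : ℝ} (hs : 0 ≤ s) (h : s ≤ t) (x : X) : anc s (anc t x) = anc s x := by
  rw [anc_anc hs (hs.trans h), min_eq_left h]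

@[simp] lemma anc_zero (x : X) : anc 0 x = base :=
  eq_base (by rw [lvl_anc le_rfl, min_eq_left (lvl_nonneg x)])

/-- The distance of the two ancestors is the larger of `|s - t|` (one lies above the other) and `s +
t - 2 * gp x y` (they are on different branches). All later Lipschitz estimates reduce to these two
bounds. -/
lemma dist_anc_anc_le {s t D : ℝ} {x y : X} (hs : 0 ≤ s) (ht : 0 ≤ t) (hx : s ≤ lvl x)
    (hy : t ≤ lvl y) (h₁ : |s - t| ≤ D) (h₂ : s + t - 2 * gp x y ≤ D) :
    dist (anc s x) (anc t y) ≤ D := by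
  rw [dist_eq, lvl_anc_of_le hs hx, lvl_anc_of_le ht hy, gp_anc_anc hs ht]
  obtain ⟨h3, h4⟩ := abs_le.1 h₁
  rcases min_cases t (gp x y) with h | h <;> rw [h.1]
  · rcases min_cases s t with h' | h' <;> rw [h'.1] <;> linarith
  · rcases min_cases s (gp x y) with h' | h' <;> rw [h'.1] <;> linarith

/-- Points joined by a path that stays at distance more than `s` from the root have the same
ancestor at distance `s`. -/
lemma le_gp_of_path {A : Type*} [TopologicalSpace A] [PreconnectedSpace A] {γ : A → X}
    (hγ : Continuous γ) {s : ℝ} (h : ∀ a, s < lvl (γ a)) (a b : A) : s ≤ gp (γ a) (γ b) := by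
  have hopen : IsOpen {c | s ≤ gp (γ a) (γ c)} ∧ IsOpen {c | s ≤ gp (γ a) (γ c)}ᶜ := by
    -- Two points above height `s` on different branches are at least `lvl (γ c) - s` apart, so
    -- nearby parameters stay on the same branch.
    have key : ∀ c, ∀ᶠ c' in nhds c, s ≤ gp (γ c) (γ c') := by
      intro c
      have : Filter.Tendsto (fun c' => dist (γ c) (γ c')) (nhds c) (nhds 0) := by
        have := (continuous_const (y := γ c)).dist hγ
        simpa using this.tendsto c
      filter_upwards [this.eventually (gt_mem_nhds (sub_pos.2 (h c)))] with c' hc'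
      have := dist_eq (γ c) (γ c')
      have := h c'
      linarith
    constructor
    · rw [isOpen_iff_eventually]
      intro c hc
      filter_upwards [key c] with c' hc' using le_gp_trans hc hc'
    · rw [isOpen_iff_eventually]
      intro c hc
      filter_upwards [key c] with c' hc' using fun h' => hc (le_gp_trans h' (gp_comm (γ c') _ ▸ hc'))
  have hcl : IsClopen {c | s ≤ gp (γ a) (γ c)} := ⟨isOpen_compl_iff.1 hopen.2, hopen.1⟩
  have := hcl.eq_univ ⟨a, by simpa using (h a).le⟩
  exact this.ge (Set.mem_univ b)

/-- The last common point of the segments from the root to `x` and to `y`. -/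
noncomputable def meet (x y : X) : X := anc (gp x y) x

lemma lvl_meet (x y : X) : lvl (meet x y) = gp x y :=
  lvl_anc_of_le (gp_nonneg x y) (gp_le_left x y)

lemma meet_comm (x y : X) : meet x y = meet y x := by
  unfold meet
  rw [gp_comm y x, anc_eq_anc_iff (gp_nonneg x y) (gp_le_left x y) (gp_le_right x y)]

/-- Two uses of hyperbolicity replace `x'` by `x` and `y'` by `y`. The product can only drop to `gp
x x'` or `gp y y'`, and each of these falls short of the corresponding height by at most the
distance moved. The bound is a maximum and not a sum, which is what makes meets of non-expansive
maps non-expansive. -/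
lemma gp_sub_le (x y x' y' : X) : gp x' y' - gp x y ≤ max (dist x x') (dist y y') := by
  have h1 := hyperbolic x x' y
  have h2 := hyperbolic x' y' y
  have e1 := dist_eq x x'
  have e2 := dist_eq y y'
  have := le_max_left (dist x x') (dist y y')
  have := le_max_right (dist x x') (dist y y')
  have := gp_comm y y'
  have a1 := gp_le_left x x'
  have a2 := gp_le_left y y'
  have a3 := gp_le_left x' y'
  have a4 := gp_le_right x' y'
  have : 0 ≤ dist x x' := dist_nonneg
  change min (gp x x') (gp x' y) ≤ gp x y at h1
  change min (gp x' y') (gp y' y) ≤ gp x' y at h2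
  rcases min_le_iff.1 h1 with h | h
  · linarith
  · rcases min_le_iff.1 h2 with h' | h' <;> linarith

lemma dist_meet_le (x y x' y' : X) :
    dist (meet x y) (meet x' y') ≤ max (dist x x') (dist y y') := by
  refine dist_anc_anc_le (gp_nonneg _ _) (gp_nonneg _ _) (gp_le_left _ _) (gp_le_left _ _) ?_ ?_
  · rw [abs_sub_comm, abs_le]
    constructor
    · have := gp_sub_le x' y' x y
      rw [dist_comm x', dist_comm y'] at this
      linarith
    · exact gp_sub_le x y x' y'
  · refine le_trans ?_ (le_max_left _ _)
    rw [dist_eq x x']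
    linarith [gp_le_left x y, gp_le_left x' y']

/-- Moving `x` and `y` towards the root, proportionally to time, down to levels `a` and `b`. -/
lemma dist_anc_convex_le {x y : X} {a b t D : ℝ} (ht : 0 ≤ t) (ht' : t ≤ 1) (ha : 0 ≤ a)
    (hb : 0 ≤ b) (hx : a ≤ lvl x) (hy : b ≤ lvl y) (h : dist x y ≤ D) (h' : |a - b| ≤ D) :
    dist (anc ((1 - t) * lvl x + t * a) x) (anc ((1 - t) * lvl y + t * b) y) ≤ D := by
  have h0 := abs_le.1 ((lvl_sub_le x y).trans h)
  have h1 := abs_le.1 h'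
  have e := dist_eq x y
  -- The difference of heights is a convex combination of `lvl x - lvl y` and `a - b`. The other
  -- bound holds because moving down only decreases the sum of the heights, which starts with `dist
  -- x y`.
  refine dist_anc_anc_le ?_ ?_ ?_ ?_ ?_ ?_
  · nlinarith
  · nlinarith
  · nlinarith
  · nlinarith
  · rw [abs_le]; constructor <;> nlinarith
  · nlinarith

lemma dist_anc_same_le {x : X} {s t : ℝ} (hs : 0 ≤ s) (ht : 0 ≤ t) (hs' : s ≤ lvl x)
    (ht' : t ≤ lvl x) : dist (anc s x) (anc t x) ≤ |s - t| := by
  refine dist_anc_anc_le hs ht hs' ht' le_rfl ?_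
  rw [gp_self]
  linarith [abs_nonneg (s - t)]

lemma continuous_anc {A : Type*} [TopologicalSpace A] {c : A → ℝ} (hc : Continuous c)
    (h0 : ∀ a, 0 ≤ c a) (x : X) : Continuous fun a => anc (c a) x := by
  -- Heights beyond the end of the segment are cut off at `lvl x`, so that `dist_anc_same_le`
  -- applies.
  have h : ∀ s : Set.Ici (0 : ℝ), anc s.1 x = anc (min s.1 (lvl x)) x := fun s => by
    apply eq_anc (by rw [lvl_anc s.2, min_assoc, min_self])
    rw [gp_anc_self s.2, lvl_anc s.2]
  have : LipschitzWith 1 fun s : Set.Ici (0 : ℝ) => anc s.1 x := by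
    refine LipschitzWith.of_dist_le_mul fun s t => ?_
    rw [h s, h t, NNReal.coe_one, one_mul]
    refine (dist_anc_same_le (le_min s.2 (lvl_nonneg x)) (le_min t.2 (lvl_nonneg x))
      (min_le_right _ _) (min_le_right _ _)).trans ?_
    refine (abs_min_sub_min_le_max _ _ _ _).trans ?_
    simp [Subtype.dist_eq, Real.dist_eq]
  exact this.continuous.comp (hc.subtype_mk h0)

/-- If `f` maps points at distance at least `m` to points at distance more than `n` from the root,
then the images of such a point and of its ancestors branch no earlier than at distance `n`. -/
lemma le_gp_comp_anc {Y : Type*} [MetricSpace Y] [RootedRTree Y] {f : X → Y} (hf : Continuous f)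
    {m n : ℝ} (hm : 0 ≤ m) (h : ∀ x, m ≤ lvl x → n < lvl (f x)) {x : X} (hx : m ≤ lvl x)
    {s : ℝ} (hs : m ≤ s) : n ≤ gp (f (anc s x)) (f x) := by
  have hc : PreconnectedSpace (Set.Ici m) :=
    isPreconnected_iff_preconnectedSpace.1 isPreconnected_Ici
  have hcont : Continuous fun r : Set.Ici m => f (anc r.1 x) :=
    hf.comp (continuous_anc continuous_subtype_val (fun r => hm.trans r.2) x)
  have := le_gp_of_path hcont (s := n) (fun r => h _ (by
    rw [lvl_anc (hm.trans r.2)]; exact le_min r.2 hx)) ⟨s, hs⟩ ⟨lvl x, hx⟩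
  simpa [anc_of_lvl_le] using this

end Basic

end RootedRTree

/-! ### The realization of a rooted tree is a rooted real tree -/

namespace SimpleGraph

/-! ### Parents, ancestors and branching of vertices. -/

variable {V : Type u} {G : SimpleGraph V}

/-- A geodesic from `r` to either neighbour avoids `a`, so it extends to a path ending at `a`. Paths
in a tree are unique, hence so is the penultimate vertex. -/
lemma IsTree.eq_of_adj_of_dist_lt (hG : G.IsTree) {r a b b' : V} (h : G.Adj b a) (h' : G.Adj b' a)
    (hd : G.dist r b + 1 = G.dist r a) (hd' : G.dist r b' + 1 = G.dist r a) : b = b' := by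
  classical
  have key : ∀ c, ∀ h : G.Adj c a, G.dist r c + 1 = G.dist r a →
      ∃ p : G.Walk r a, p.IsPath ∧ p.penultimate = c := by
    intro c h hd
    obtain ⟨p, hp, hl⟩ := (hG.connected r c).exists_path_of_dist
    refine ⟨p.concat h, hp.concat (fun hmem => ?_) h, by simp⟩
    have h1 := dist_le (p.takeUntil a hmem)
    have h2 := p.length_takeUntil_le_length hmem
    omega
  obtain ⟨p, hp, rfl⟩ := key b h hd
  obtain ⟨q, hq, rfl⟩ := key b' h' hd'
  rw [(hG.existsUnique_path r a).unique hp hq]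

lemma IsTree.exists_adj_dist_lt (hG : G.IsTree) {r a : V} (h : G.dist r a ≠ 0) :
    ∃ b, G.Adj b a ∧ G.dist r b + 1 = G.dist r a := by
  obtain ⟨p, hp⟩ := (hG.connected a r).exists_walk_length_eq_dist
  cases p with
  | nil => simp at h
  | @cons _ b _ hab p =>
    refine ⟨b, hab.symm, ?_⟩
    have h1 := dist_le p
    have h2 := hab.diff_dist_adj (u := r)
    rw [Walk.length_cons, dist_comm] at hp
    rw [dist_comm] at h1
    omega

variable (G) in
/-- The neighbour of `a` on the way to the root `r`. -/
noncomputable def parent (r a : V) : V :=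
  open Classical in
  if h : ∃ b, G.Adj b a ∧ G.dist r b + 1 = G.dist r a then h.choose else a

lemma IsTree.parent_spec (hG : G.IsTree) {r a : V} (h : G.dist r a ≠ 0) :
    G.Adj (G.parent r a) a ∧ G.dist r (G.parent r a) + 1 = G.dist r a := by
  have := hG.exists_adj_dist_lt h
  rw [parent, dif_pos this]
  exact this.choose_spec

lemma IsTree.eq_parent (hG : G.IsTree) {r a b : V} (h : G.Adj b a)
    (hd : G.dist r b + 1 = G.dist r a) : b = G.parent r a := by
  have := hG.parent_spec (r := r) (a := a) (by omega)
  exact hG.eq_of_adj_of_dist_lt h this.1 hd this.2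

variable (G) in
/-- The vertex at distance `n` from the root `r` on the path from `r` to `a`, or `a` if there is no
such vertex. -/
noncomputable def ancestor (r : V) (n : ℕ) (a : V) : V := (G.parent r)^[G.dist r a - n] a

lemma ancestor_of_le {r a : V} {n : ℕ} (h : G.dist r a ≤ n) : G.ancestor r n a = a := by
  rw [ancestor, Nat.sub_eq_zero_of_le h, Function.iterate_zero_apply]

lemma IsTree.ancestor_parent (hG : G.IsTree) {r a : V} {n : ℕ} (h : n < G.dist r a) :
    G.ancestor r n (G.parent r a) = G.ancestor r n a := by
  have := (hG.parent_spec (r := r) (a := a) (by omega)).2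
  rw [ancestor, ancestor, ← Function.iterate_succ_apply]
  congr 2
  omega

lemma IsTree.ancestor_induction (hG : G.IsTree) {r : V} {n : ℕ} {P : V → Prop}
    (h₁ : ∀ a, G.dist r a ≤ n → P a) (h₂ : ∀ a, n < G.dist r a → P (G.parent r a) → P a) (a : V) :
    P a := by
  induction h : G.dist r a using Nat.strong_induction_on generalizing a with
  | _ k ih =>
    rcases le_or_gt (G.dist r a) n with h' | h'
    · exact h₁ a h'
    · exact h₂ a h' (ih _ (by have := (hG.parent_spec (r := r) (a := a) (by omega)).2; omega) _ rfl)

lemma IsTree.dist_ancestor (hG : G.IsTree) (r : V) (n : ℕ) (a : V) :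
    G.dist r (G.ancestor r n a) = min n (G.dist r a) := by
  induction a using hG.ancestor_induction (r := r) (n := n) with
  | h₁ a h => rw [ancestor_of_le h, min_eq_right h]
  | h₂ a h ih =>
    have := (hG.parent_spec (r := r) (a := a) (by omega)).2
    rw [← hG.ancestor_parent h, ih]
    omega

lemma IsTree.ancestor_ancestor (hG : G.IsTree) (r : V) {n m : ℕ} (hnm : n ≤ m) (a : V) :
    G.ancestor r n (G.ancestor r m a) = G.ancestor r n a := by
  induction a using hG.ancestor_induction (r := r) (n := m) with
  | h₁ a h => rw [ancestor_of_le h]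
  | h₂ a h ih => rw [← hG.ancestor_parent h, ih, hG.ancestor_parent (hnm.trans_lt h)]

lemma IsTree.ancestor_zero (hG : G.IsTree) (r a : V) : G.ancestor r 0 a = r := by
  have := hG.dist_ancestor r 0 a
  rw [Nat.zero_min] at this
  exact ((hG.connected r _).dist_eq_zero_iff.1 this).symm

lemma ancestor_eq_parent {r a : V} {n : ℕ} (h : n + 1 = G.dist r a) :
    G.ancestor r n a = G.parent r a := by
  rw [ancestor, ← h, Nat.add_sub_cancel_left, Function.iterate_one]

lemma IsTree.adj_ancestor (hG : G.IsTree) {r a : V} {n : ℕ} (h : n < G.dist r a) :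
    G.Adj (G.ancestor r n a) (G.ancestor r (n + 1) a) := by
  have hd := hG.dist_ancestor r (n + 1) a
  rw [min_eq_left h] at hd
  rw [← hG.ancestor_ancestor r n.le_succ, ancestor_eq_parent hd.symm]
  exact (hG.parent_spec (by omega)).1

variable (G) in
/-- The distance from the root `r` at which the paths to `a` and `b` branch. -/
noncomputable def branchLevel (r a b : V) : ℕ :=
  open Classical in
  Nat.findGreatest (fun n => G.ancestor r n a = G.ancestor r n b) (min (G.dist r a) (G.dist r b))

lemma branchLevel_le (r a b : V) : G.branchLevel r a b ≤ min (G.dist r a) (G.dist r b) := by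
  classical exact Nat.findGreatest_le _

lemma IsTree.ancestor_branchLevel (hG : G.IsTree) (r a b : V) :
    G.ancestor r (G.branchLevel r a b) a = G.ancestor r (G.branchLevel r a b) b := by
  classical
  exact Nat.findGreatest_spec (P := fun n => G.ancestor r n a = G.ancestor r n b) (Nat.zero_le _)
    (by rw [hG.ancestor_zero, hG.ancestor_zero])

lemma IsTree.le_branchLevel_iff (hG : G.IsTree) {r a b : V} {n : ℕ} :
    n ≤ G.branchLevel r a b ↔
      n ≤ G.dist r a ∧ n ≤ G.dist r b ∧ G.ancestor r n a = G.ancestor r n b := by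
  classical
  constructor
  · intro h
    have h' := le_min_iff.1 (h.trans (branchLevel_le r a b))
    refine ⟨h'.1, h'.2, ?_⟩
    rw [← hG.ancestor_ancestor r h, hG.ancestor_branchLevel, hG.ancestor_ancestor r h]
  · rintro ⟨h1, h2, h3⟩
    exact Nat.le_findGreatest (le_min h1 h2) h3

lemma IsTree.branchLevel_trans (hG : G.IsTree) (r a b c : V) :
    min (G.branchLevel r a b) (G.branchLevel r b c) ≤ G.branchLevel r a c := by
  obtain ⟨h1, -, h3⟩ := hG.le_branchLevel_iff.1 (min_le_left (G.branchLevel r a b) (G.branchLevel r b c))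
  obtain ⟨-, h2', h3'⟩ := hG.le_branchLevel_iff.1 (min_le_right (G.branchLevel r a b) (G.branchLevel r b c))
  exact hG.le_branchLevel_iff.2 ⟨h1, h2', h3.trans h3'⟩

/-! ### Barycentric coordinates along the segments from the root. -/

variable (G) in
/-- The barycentric coordinates of the point at distance `s` from the root `r` on the segment from
`r` to `a`. -/
noncomputable def pathCoord (r a : V) (s : ℝ) : V →₀ ℝ :=
  (1 - Int.fract s) • Finsupp.single (G.ancestor r ⌊s⌋₊ a) 1 +
    Int.fract s • Finsupp.single (G.ancestor r (⌊s⌋₊ + 1) a) 1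

/-- At the right end `s = n + 1` the floor jumps, but the formulas for the two adjacent edges agree
there. This allows work on closed edges. -/
lemma pathCoord_eq (r a : V) {s : ℝ} {n : ℕ} (h : (n : ℝ) ≤ s) (h' : s ≤ n + 1) :
    G.pathCoord r a s = (n + 1 - s) • Finsupp.single (G.ancestor r n a) 1 +
      (s - n) • Finsupp.single (G.ancestor r (n + 1) a) 1 := by
  rcases h'.lt_or_eq with h' | rfl
  · have hf : ⌊s⌋₊ = n := (Nat.floor_eq_iff (n.cast_nonneg.trans h)).2 ⟨h, h'⟩
    have hf' : Int.fract s = s - n := by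
      rw [Int.fract_eq_iff]
      exact ⟨by linarith, by linarith, n, by simp⟩
    rw [pathCoord, hf, hf']
    congr 2
    ring
  · have hf : ⌊(n : ℝ) + 1⌋₊ = n + 1 := by exact_mod_cast Nat.floor_natCast (R := ℝ) (n + 1)
    have hf' : Int.fract ((n : ℝ) + 1) = 0 := by exact_mod_cast Int.fract_natCast (R := ℝ) (n + 1)
    rw [pathCoord, hf, hf']
    simp

lemma pathCoord_mem (r a : V) {s : ℝ} {n : ℕ} (h : (n : ℝ) ≤ s) (h' : s ≤ n + 1) :
    G.pathCoord r a s ∈ closedEdge (G.ancestor r n a) (G.ancestor r (n + 1) a) :=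
  ⟨n + 1 - s, s - n, by linarith, by linarith, by ring, (pathCoord_eq r a h h').symm⟩

lemma pathCoord_natCast (r a : V) (n : ℕ) :
    G.pathCoord r a n = Finsupp.single (G.ancestor r n a) 1 := by
  rw [pathCoord_eq r a le_rfl (by linarith)]
  simp

lemma IsTree.pathCoord_congr (hG : G.IsTree) {r a b : V} {s : ℝ} (h0 : 0 ≤ s)
    (h : s ≤ G.branchLevel r a b) : G.pathCoord r a s = G.pathCoord r b s := by
  have hn : ⌊s⌋₊ ≤ G.branchLevel r a b := Nat.floor_le_of_le h
  rcases hn.lt_or_eq with hn | hn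
  · obtain ⟨-, -, h1⟩ := hG.le_branchLevel_iff.1 hn.le
    obtain ⟨-, -, h2⟩ := hG.le_branchLevel_iff.1 (Nat.succ_le_of_lt hn)
    rw [pathCoord, pathCoord, h1, h2]
  · have hs : s = G.branchLevel r a b := le_antisymm h (hn ▸ Nat.floor_le h0)
    rw [hs, pathCoord_natCast, pathCoord_natCast, hG.ancestor_branchLevel]

lemma IsTree.pathCoord_apply (hG : G.IsTree) {r a : V} {s : ℝ} {n : ℕ} (h : (n : ℝ) ≤ s)
    (h' : s ≤ n + 1) (hn : n < G.dist r a) :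
    G.pathCoord r a s (G.ancestor r (n + 1) a) = s - n := by
  rw [pathCoord_eq r a h h']
  simp [(hG.adj_ancestor hn).ne]

variable (G) in
/-- The linear extension of the distance from the root on vertices. -/
noncomputable def level (r : V) : (V →₀ ℝ) →ₗ[ℝ] ℝ :=
  Finsupp.linearCombination ℝ fun a => (G.dist r a : ℝ)

lemma IsTree.level_pathCoord (hG : G.IsTree) {r a : V} {s : ℝ} (h0 : 0 ≤ s)
    (h : s ≤ G.dist r a) : G.level r (G.pathCoord r a s) = s := by
  rw [pathCoord_eq r a (Nat.floor_le h0) (Nat.lt_floor_add_one s).le]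
  have h1 : ⌊s⌋₊ ≤ G.dist r a := Nat.floor_le_of_le h
  simp only [level, map_add, map_smul, Finsupp.linearCombination_single, hG.dist_ancestor,
    min_eq_left h1, smul_eq_mul, one_mul]
  rcases h1.lt_or_eq with h1 | h1
  · rw [min_eq_left (Nat.succ_le_of_lt h1)]
    push_cast
    ring
  · have : s = ⌊s⌋₊ := le_antisymm (by rwa [h1]) (Nat.floor_le h0)
    rw [sub_eq_zero.2 this, zero_mul, add_zero, (by linarith : (⌊s⌋₊ : ℝ) + 1 - s = 1), one_mul,
      ← this]

/-- The functional `level` recovers the height from the point. Inside an edge, the nonzero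
coordinate at the upper end forces the two upper ends to coincide; at integral height the point is
itself a vertex. -/
lemma IsTree.le_branchLevel_of_pathCoord_eq (hG : G.IsTree) {r a b : V} {s t : ℝ} (hs : 0 ≤ s)
    (ht : 0 ≤ t) (hs' : s ≤ G.dist r a) (ht' : t ≤ G.dist r b)
    (h : G.pathCoord r a s = G.pathCoord r b t) : s = t ∧ s ≤ G.branchLevel r a b := by
  have hst : s = t := by
    rw [← hG.level_pathCoord hs hs', h, hG.level_pathCoord ht ht']
  subst hst
  refine ⟨rfl, ?_⟩
  set n := ⌊s⌋₊ with hn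
  have h1 : (n : ℝ) ≤ s := Nat.floor_le hs
  have h2 : s ≤ n + 1 := (Nat.lt_floor_add_one s).le
  rcases h1.lt_or_eq with h3 | h3
  · have ha : n < G.dist r a := by exact_mod_cast h3.trans_le hs'
    have hb : n < G.dist r b := by exact_mod_cast h3.trans_le ht'
    have hne : G.pathCoord r b s (G.ancestor r (n + 1) a) ≠ 0 := by
      rw [← h, hG.pathCoord_apply h1 h2 ha]
      exact (sub_pos.2 h3).ne'
    have hda := hG.dist_ancestor r (n + 1) a
    have hdb := hG.dist_ancestor r n b
    rw [min_eq_left ha] at hda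
    rw [min_eq_left hb.le] at hdb
    have h4 : G.ancestor r (n + 1) a = G.ancestor r (n + 1) b := by
      by_contra hne'
      apply hne
      rw [pathCoord_eq r b h1 h2]
      have : G.ancestor r n b ≠ G.ancestor r (n + 1) a := by
        intro h
        rw [h] at hdb
        omega
      simp [this, Ne.symm hne']
    refine h2.trans ?_
    exact_mod_cast hG.le_branchLevel_iff.2 ⟨ha, hb, h4⟩
  · rw [← h3]
    rw [← h3] at hs' ht' h
    rw [pathCoord_natCast, pathCoord_natCast] at h
    exact Nat.cast_le.2 (hG.le_branchLevel_iff.2 ⟨by exact_mod_cast hs', by exact_mod_cast ht',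
      (Finsupp.single_left_inj one_ne_zero).1 h⟩)

/-- The point at distance `s` from the root `r` on the segment from `r` to `a`. -/
noncomputable def IsTree.pathPoint (hG : G.IsTree) (r a : V) (s : ℝ) : G.Realization :=
  ⟨G.pathCoord r a s, G.ancestor r ⌊s⌋₊ a, G.ancestor r (⌊s⌋₊ + 1) a, by
    rcases le_or_gt (G.dist r a) ⌊s⌋₊ with h | h
    · left
      rw [ancestor_of_le h, ancestor_of_le (h.trans (Nat.le_succ _))]
    · exact Or.inr (hG.adj_ancestor h), 1 - Int.fract s, Int.fract s,
    sub_nonneg.2 (Int.fract_lt_one s).le, Int.fract_nonneg s, by ring, rfl⟩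

lemma IsTree.pathPoint_natCast (hG : G.IsTree) (r a : V) (n : ℕ) :
    hG.pathPoint r a n = Realization.vertex (G.ancestor r n a) :=
  Subtype.ext (pathCoord_natCast r a n)

lemma IsTree.pathPoint_zero (hG : G.IsTree) (r a : V) :
    hG.pathPoint r a 0 = Realization.vertex r := by
  have := hG.pathPoint_natCast r a 0
  rwa [Nat.cast_zero, hG.ancestor_zero] at this

lemma IsTree.pathPoint_dist (hG : G.IsTree) (r a : V) :
    hG.pathPoint r a (G.dist r a) = Realization.vertex a := by
  rw [pathPoint_natCast, ancestor_of_le le_rfl]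

/-- A point of the edge from `b` to the next vertex `a` is on the segment to `a`. -/
lemma IsTree.exists_pathCoord_of_mem (hG : G.IsTree) {r a b : V} (h : G.Adj b a)
    (hd : G.dist r b + 1 = G.dist r a) {x : V →₀ ℝ} (hx : x ∈ closedEdge b a) :
    ∃ s : ℝ, 0 ≤ s ∧ s ≤ G.dist r a ∧ x = G.pathCoord r a s ∧ x a = s - G.dist r b := by
  have hb : G.ancestor r (G.dist r b) a = b := by
    rw [ancestor_eq_parent hd, ← hG.eq_parent h hd]
  have hd' : (G.dist r b : ℝ) + 1 = G.dist r a := by exact_mod_cast hd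
  have hnn : (0 : ℝ) ≤ G.dist r b := Nat.cast_nonneg _
  obtain ⟨p, q, hp, hq, hpq, rfl⟩ := hx
  refine ⟨G.dist r b + q, by linarith, by linarith, ?_, ?_⟩
  · rw [pathCoord_eq r a (n := G.dist r b) (by linarith) (by linarith), hb, hd,
      ancestor_of_le le_rfl]
    congr 2 <;> linarith
  · simp [h.ne]

lemma IsTree.exists_pathPoint (hG : G.IsTree) (r : V) (x : G.Realization) :
    ∃ (a : V) (s : ℝ), 0 ≤ s ∧ s ≤ G.dist r a ∧ x = hG.pathPoint r a s := by
  obtain ⟨x, a, b, h | h, hx⟩ := x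
  · subst h
    have hx' : x = Finsupp.single a 1 := by simpa [closedEdge] using hx
    subst hx'
    exact ⟨a, G.dist r a, Nat.cast_nonneg _, le_rfl, (hG.pathPoint_dist r a).symm⟩
  · rcases hG.dist_eq_dist_add_one_of_adj r h with hd | hd
    · have hx' : x ∈ closedEdge b a := by rwa [closedEdge, segment_symm]
      obtain ⟨s, h1, h2, h3, -⟩ := hG.exists_pathCoord_of_mem h.symm hd.symm hx'
      exact ⟨a, s, h1, h2, Subtype.ext h3⟩
    · obtain ⟨s, h1, h2, h3, -⟩ := hG.exists_pathCoord_of_mem h hd.symm hx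
      exact ⟨b, s, h1, h2, Subtype.ext h3⟩

/-- On a common closed edge, two points lie on the segment to the farther end. -/
lemma IsTree.exists_pathPoint_of_mem_closedEdge (hG : G.IsTree) (r : V) {a b : V} (h : G.Adj a b)
    {x y : G.Realization} (hx : x.1 ∈ closedEdge a b) (hy : y.1 ∈ closedEdge a b) :
    ∃ (c : V) (s t : ℝ), 0 ≤ s ∧ s ≤ G.dist r c ∧ 0 ≤ t ∧ t ≤ G.dist r c ∧ x = hG.pathPoint r c s ∧
      y = hG.pathPoint r c t ∧ |x.1 a - y.1 a| = |s - t| := by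
  rcases hG.dist_eq_dist_add_one_of_adj r h with hd | hd
  · rw [closedEdge, segment_symm] at hx hy
    obtain ⟨s, h1, h2, h3, h4⟩ := hG.exists_pathCoord_of_mem h.symm hd.symm hx
    obtain ⟨t, i1, i2, i3, i4⟩ := hG.exists_pathCoord_of_mem h.symm hd.symm hy
    refine ⟨a, s, t, h1, h2, i1, i2, Subtype.ext h3, Subtype.ext i3, ?_⟩
    rw [h4, i4]
    congr 1
    ring
  · obtain ⟨s, h1, h2, h3, h4⟩ := hG.exists_pathCoord_of_mem h hd.symm hx
    obtain ⟨t, i1, i2, i3, i4⟩ := hG.exists_pathCoord_of_mem h hd.symm hy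
    refine ⟨b, s, t, h1, h2, i1, i2, Subtype.ext h3, Subtype.ext i3, ?_⟩
    rw [(closedEdge_apply h.ne hx).1] at h4
    rw [(closedEdge_apply h.ne hy).1] at i4
    rw [← abs_neg]
    congr 1
    linarith

/-! ### Computation of the length metric. -/

lemma IsTree.pathLength_step (hG : G.IsTree) {r a : V} {s t : ℝ} {n : ℕ} (hn : n < G.dist r a)
    (hs : (n : ℝ) ≤ s) (hst : s ≤ t) (ht : t ≤ n + 1) :
    PathLength (hG.pathPoint r a s) (hG.pathPoint r a t) (t - s) := by
  have hs' : s ≤ n + 1 := hst.trans ht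
  have ht' : (n : ℝ) ≤ t := hs.trans hst
  have h1 := hG.pathCoord_apply hs hs' hn
  have h2 := hG.pathCoord_apply ht' ht hn
  have hx := pathCoord_mem (G := G) r a hs hs'
  have hy := pathCoord_mem (G := G) r a ht' ht
  rw [closedEdge, segment_symm] at hx hy
  have := PathLength.step (x := hG.pathPoint r a s) (y := hG.pathPoint r a t)
    (hG.adj_ancestor hn).symm hx hy (.refl _)
  change PathLength _ _ (|G.pathCoord r a s _ - G.pathCoord r a t _| + 0) at this
  rw [h1, h2, add_zero, show s - (n : ℝ) - (t - n) = -(t - s) by ring, abs_neg,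
    abs_of_nonneg (sub_nonneg.2 hst)] at this
  exact this

lemma IsTree.pathLength_pathPoint (hG : G.IsTree) {r a : V} {s t : ℝ} (hs : 0 ≤ s) (hst : s ≤ t)
    (ht : t ≤ G.dist r a) : PathLength (hG.pathPoint r a s) (hG.pathPoint r a t) (t - s) := by
  have key : ∀ n ≤ G.dist r a, ∀ s t : ℝ, 0 ≤ s → s ≤ t → t ≤ n →
      PathLength (hG.pathPoint r a s) (hG.pathPoint r a t) (t - s) := by
    intro n hn
    induction n with
    | zero =>
      intro s t hs hst ht
      have h0 : s = t := by rw [Nat.cast_zero] at ht; linarith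
      subst h0
      rw [sub_self]
      exact .refl _
    | succ n ih =>
      intro s t hs hst ht
      push_cast at ht
      rcases le_total t n with h | h
      · exact ih (by omega) s t hs hst h
      · rcases le_total (n : ℝ) s with h' | h'
        · exact hG.pathLength_step hn h' hst ht
        · have := (ih (by omega) s n hs h' le_rfl).trans (hG.pathLength_step hn le_rfl h ht)
          convert this using 1
          ring
  exact key _ le_rfl s t hs hst ht

/-- The formula for the distance in a rooted tree. -/
lemma IsTree.pathDist_pathPoint (hG : G.IsTree) {r a b : V} {s t : ℝ} (hs : 0 ≤ s)
    (hs' : s ≤ G.dist r a) (ht : 0 ≤ t) (ht' : t ≤ G.dist r b) :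
    pathDist (hG.pathPoint r a s) (hG.pathPoint r b t) =
      s + t - 2 * min s (min t (G.branchLevel r a b)) := by
  apply le_antisymm
  · apply pathDist_le
    -- The shortest path descends to the height `c` of the last common point and climbs again.
    set c := min s (min t (G.branchLevel r a b : ℝ)) with hc
    have h0 : 0 ≤ c := le_min hs (le_min ht (Nat.cast_nonneg _))
    have h1 : c ≤ s := min_le_left _ _
    have h2 : c ≤ t := (min_le_right _ _).trans (min_le_left _ _)
    have h3 : c ≤ G.branchLevel r a b := (min_le_right _ _).trans (min_le_right _ _)
    have e : hG.pathPoint r a c = hG.pathPoint r b c := Subtype.ext (hG.pathCoord_congr h0 h3)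
    have p := (hG.pathLength_pathPoint h0 h1 hs').symm
    rw [e] at p
    have := p.trans (hG.pathLength_pathPoint h0 h2 ht')
    convert this using 1
    ring
  · refine le_csInf (PathLength.exists_of_connected hG.connected _ _) fun l hl => ?_
    -- The induction ranges over all descriptions of the end points, since a point lies on the
    -- segments to many vertices. A link of the chain stays on one segment, and the triangle
    -- inequality for the formula follows from `branchLevel_trans`.
    have key : ∀ {x y : G.Realization} {l : ℝ}, PathLength x y l → ∀ {a b : V} {s t : ℝ}, 0 ≤ s →
        s ≤ G.dist r a → 0 ≤ t → t ≤ G.dist r b → x = hG.pathPoint r a s →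
        y = hG.pathPoint r b t → s + t - 2 * min s (min t (G.branchLevel r a b)) ≤ l := by
      intro x y l h
      induction h with
      | refl x =>
        intro a b s t hs hs' ht ht' hx hy
        obtain ⟨rfl, h⟩ := hG.le_branchLevel_of_pathCoord_eq hs ht hs' ht'
          (congrArg Subtype.val (hx.symm.trans hy))
        rw [min_eq_left h, min_self]
        linarith
      | @step x y z a' b' l hab hx hy _ ih =>
        intro a b s t hs hs' ht ht' hxa hzb
        obtain ⟨c, s', u, h1, h2, h3, h4, h5, h6, h7⟩ :=
          hG.exists_pathPoint_of_mem_closedEdge r hab hx hy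
        have := ih h3 h4 ht ht' h6 hzb
        obtain ⟨rfl, h8⟩ := hG.le_branchLevel_of_pathCoord_eq hs h1 hs' h2
          (congrArg Subtype.val (hxa.symm.trans h5))
        rw [h7]
        have h9 : min (G.branchLevel r a c : ℝ) (G.branchLevel r c b) ≤ G.branchLevel r a b := by
          exact_mod_cast hG.branchLevel_trans r a c b
        have h10 := le_abs_self (s - u)
        have h11 := neg_abs_le (s - u)
        rcases min_le_iff.1 h9 with h | h <;>
        rcases min_cases t (G.branchLevel r a b : ℝ) with i | i <;> rw [i.1] <;>
        rcases min_cases s _ with j | j <;> rw [j.1] <;>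
        rcases min_cases t (G.branchLevel r c b : ℝ) with k | k <;> rw [k.1] at this <;>
        rcases min_cases u _ with m | m <;> rw [m.1] at this <;> linarith
    exact key hl hs hs' ht ht' rfl rfl

end SimpleGraph

namespace RootedSimplicialTree

variable (T : RootedSimplicialTree.{u})

/-- The number of edges from the root to `a`. -/
noncomputable def depth (a : T.V) : ℕ := T.graph.dist T.rootVertex a

/-- The point at distance `s` from the root on the segment from the root to the vertex `a`. -/
noncomputable def point (a : T.V) (s : ℝ) : T.Space := T.isTree.pathPoint T.rootVertex a s

/-- A vertex as a point of the realization. -/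
noncomputable def vertex (a : T.V) : T.Space := SimpleGraph.Realization.vertex a

lemma dist_point {a b : T.V} {s t : ℝ} (hs : 0 ≤ s) (hs' : s ≤ T.depth a) (ht : 0 ≤ t)
    (ht' : t ≤ T.depth b) : dist (T.point a s) (T.point b t) =
      s + t - 2 * min s (min t (T.graph.branchLevel T.rootVertex a b)) :=
  T.isTree.pathDist_pathPoint hs hs' ht ht'

lemma exists_point (x : T.Space) : ∃ (a : T.V) (s : ℝ), 0 ≤ s ∧ s ≤ T.depth a ∧ x = T.point a s :=
  T.isTree.exists_pathPoint T.rootVertex x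

lemma dist_root_point {a : T.V} {s : ℝ} (hs : 0 ≤ s) (hs' : s ≤ T.depth a) :
    dist T.root (T.point a s) = s := by
  have h := T.dist_point (a := a) le_rfl (Nat.cast_nonneg _) hs hs'
  have e : T.point a 0 = T.root := T.isTree.pathPoint_zero _ _
  rw [e, min_eq_left (le_min hs (Nat.cast_nonneg _))] at h
  linarith

lemma gromovProduct_point {a b : T.V} {s t : ℝ} (hs : 0 ≤ s) (hs' : s ≤ T.depth a) (ht : 0 ≤ t)
    (ht' : t ≤ T.depth b) : gromovProduct T.root (T.point a s) (T.point b t) =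
      min s (min t (T.graph.branchLevel T.rootVertex a b)) := by
  rw [gromovProduct, T.dist_root_point hs hs', T.dist_root_point ht ht', T.dist_point hs hs' ht ht']
  ring

noncomputable instance : RootedRTree T.Space where
  base := T.root
  -- The chosen description of `x` is immaterial, because the Gromov products of the resulting point
  -- do not depend on it.
  anc s x := T.point (T.exists_point x).choose (min s (T.exists_point x).choose_spec.choose)
  gromovProduct_anc s hs x y := by
    obtain ⟨h1, h2, h3⟩ := (T.exists_point x).choose_spec.choose_spec
    obtain ⟨b, r, hr, hr', rfl⟩ := T.exists_point y
    generalize (T.exists_point x).choose_spec.choose = t at h1 h2 h3 ⊢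
    generalize (T.exists_point x).choose = a at h2 h3 ⊢
    rw [h3, T.gromovProduct_point (le_min hs h1) ((min_le_right _ _).trans h2) hr hr',
      T.gromovProduct_point h1 h2 hr hr', min_assoc]
  hyperbolic x y z := by
    obtain ⟨a, s, hs, hs', rfl⟩ := T.exists_point x
    obtain ⟨b, t, ht, ht', rfl⟩ := T.exists_point y
    obtain ⟨c, u, hu, hu', rfl⟩ := T.exists_point z
    rw [T.gromovProduct_point hs hs' ht ht', T.gromovProduct_point ht ht' hu hu',
      T.gromovProduct_point hs hs' hu hu']
    have h : min (T.graph.branchLevel T.rootVertex a b : ℝ) (T.graph.branchLevel T.rootVertex b c) ≤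
        T.graph.branchLevel T.rootVertex a c := by
      exact_mod_cast T.isTree.branchLevel_trans T.rootVertex a b c
    refine le_min ?_ (le_min ?_ ?_)
    · exact (min_le_left _ _).trans (min_le_left _ _)
    · exact (min_le_right _ _).trans ((min_le_right _ _).trans (min_le_left _ _))
    · refine (min_le_min ?_ ?_).trans h <;> exact (min_le_right _ _).trans (min_le_right _ _)

open RootedRTree

lemma lvl_vertex (a : T.V) : lvl (T.vertex a) = T.depth a := by
  have := T.dist_root_point (a := a) (Nat.cast_nonneg _) le_rfl
  rwa [point, depth, T.isTree.pathPoint_dist] at this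

lemma vertex_injective : Function.Injective T.vertex := fun _ _ h =>
  (Finsupp.single_left_inj one_ne_zero).1 (congrArg Subtype.val h)

lemma exists_vertex_of_lvl {x : T.Space} {n : ℕ} (h : lvl x = n) : ∃ a, x = T.vertex a := by
  obtain ⟨a, s, hs, hs', rfl⟩ := T.exists_point x
  have : s = n := (T.dist_root_point hs hs').symm.trans h
  subst this
  exact ⟨_, T.isTree.pathPoint_natCast _ _ _⟩

/-- Heights differing by one together with distance at most one force `gp` to be the full height of
the lower vertex. -/
lemma vertex_eq_anc {a b : T.V} (h : T.graph.Adj a b) (hd : T.depth b = T.depth a + 1) :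
    T.vertex a = anc (T.depth a : ℝ) (T.vertex b) := by
  have h1 := T.lvl_vertex a
  have h2 := T.lvl_vertex b
  have h3 : ((T.depth b : ℕ) : ℝ) = T.depth a + 1 := by exact_mod_cast hd
  refine eq_anc (by rw [h1, h2, min_eq_left (by linarith)]) (le_antisymm (gp_le_left _ _) ?_)
  have h4 : dist (T.vertex a) (T.vertex b) ≤ 1 := by
    have := SimpleGraph.pathDist_le (.step (x := T.vertex a) (y := T.vertex b) h
      (left_mem_segment ℝ _ _) (right_mem_segment ℝ _ _) (.refl _))
    refine this.trans (le_of_eq ?_)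
    simp [vertex, SimpleGraph.Realization.vertex, h.ne']
  have := dist_eq (T.vertex a) (T.vertex b)
  linarith

end RootedSimplicialTree

/-! ### Homotopies of non-expansive maps -/

namespace RootedSimplicialTree

open RootedRTree

variable {S T U : RootedSimplicialTree.{u}}

/-- The strict inequality on the right is the form that `le_gp_of_path` requires. -/
lemma metricallyProper_iff {F : S.Space → T.Space} :
    MetricallyProper F ↔ ∀ n : ℕ, ∃ N : ℕ, ∀ x, (N : ℝ) ≤ lvl x → (n : ℝ) < lvl (F x) := by
  constructor
  · intro h n
    obtain ⟨r, hr⟩ := (h _ (Metric.isBounded_closedBall (x := T.root) (r := n))).subset_ball S.root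
    obtain ⟨N, hN⟩ := exists_nat_ge r
    refine ⟨N, fun x hx => not_le.1 fun h' => ?_⟩
    have := hr (show x ∈ F ⁻¹' _ from (Metric.mem_closedBall'.2 h'))
    exact absurd (Metric.mem_ball'.1 this) (not_lt.2 (hN.trans hx))
  · intro h A hA
    obtain ⟨r, hr⟩ := hA.subset_ball T.root
    obtain ⟨n, hn⟩ := exists_nat_ge r
    obtain ⟨N, hN⟩ := h n
    refine (Metric.isBounded_ball (x := S.root) (r := N)).subset fun x hx => ?_
    refine Metric.mem_ball'.2 (not_le.1 fun h' => ?_)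
    exact absurd (Metric.mem_ball'.1 (hr hx)) (not_lt.2 (hn.trans (hN x h').le))

namespace NEMap

lemma dist_le (f : NEMap S T) (x y : S.Space) : dist (f.toFun x) (f.toFun y) ≤ dist x y := by
  simpa using f.nonexpansive.dist_le_mul x y

/-- The maps `f` and `g` have arbitrarily long common initial segments far from the root. -/
def Close (f g : NEMap S T) : Prop :=
  ∀ n : ℕ, ∃ N : ℕ, ∀ x, (N : ℝ) ≤ lvl x → (n : ℝ) ≤ gp (f.toFun x) (g.toFun x)

lemma Close.symm {f g : NEMap S T} (h : f.Close g) : g.Close f := fun n => by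
  obtain ⟨N, hN⟩ := h n
  exact ⟨N, fun x hx => by rw [gp_comm]; exact hN x hx⟩

lemma Homotopic.close {f g : NEMap S T} (h : f.Homotopic g) : f.Close g := by
  obtain ⟨H, -, h2, -⟩ := h
  intro n
  -- Radius `n + 1` leaves room for the strict inequality `n < lvl (H (t, x))`.
  obtain ⟨N, -, hN⟩ := h2 (n + 1) (by positivity)
  obtain ⟨k, hk⟩ := exists_nat_ge N
  refine ⟨k, fun x hx => ?_⟩
  have key : ∀ t, (n : ℝ) < lvl (H (t, x)) := by
    intro t
    by_contra hlt
    have h1 : H (t, x) ∈ Metric.ball T.root (n + 1) := by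
      rw [Metric.mem_ball']
      exact (not_lt.1 hlt).trans_lt (lt_add_one _)
    exact absurd (Metric.mem_ball'.1 (hN t x h1)) (not_lt.2 (hk.trans hx))
  have := le_gp_of_path (γ := fun t => H (t, x)) (by fun_prop) key 0 1
  have h0 : H (0, x) = f.toFun x := H.apply_zero x
  have h1 : H (1, x) = g.toFun x := H.apply_one x
  rwa [h0, h1] at this

/-- The pointwise meet of two non-expansive maps. -/
noncomputable def meet (f g : NEMap S T) (h : f.Close g) : NEMap S T where
  toFun x := RootedRTree.meet (f.toFun x) (g.toFun x)
  map_root := by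
    rw [f.map_root, g.map_root]
    refine eq_base ?_
    rw [lvl_meet, gp_self]
    exact lvl_base
  proper := metricallyProper_iff.2 fun n => by
    -- Closeness at `n + 1` gives the strict bound at `n`.
    obtain ⟨N, hN⟩ := h (n + 1)
    refine ⟨N, fun x hx => ?_⟩
    rw [lvl_meet]
    have := hN x hx
    push_cast at this
    linarith
  nonexpansive := LipschitzWith.of_dist_le_mul fun x y => by
    rw [NNReal.coe_one, one_mul]
    exact (dist_meet_le _ _ _ _).trans (max_le (f.dist_le x y) (g.dist_le x y))

lemma meet_comm {f g : NEMap S T} (h : f.Close g) : f.meet g h = g.meet f h.symm := by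
  unfold meet
  congr 1
  funext x
  exact RootedRTree.meet_comm _ _

/-- Each `f x` slides down its segment, at height interpolated linearly, until it reaches the meet.
It never sinks below `gp (f x) (g x)`, so closeness gives uniform properness, while
`dist_anc_convex_le` makes every stage non-expansive. -/
lemma Close.homotopic_meet {f g : NEMap S T} (h : f.Close g) : f.Homotopic (f.meet g h) := by
  let c : unitInterval × S.Space → ℝ := fun p =>
    (1 - (p.1 : ℝ)) * lvl (f.toFun p.2) + p.1 * gp (f.toFun p.2) (g.toFun p.2)
  have c_le : ∀ p, c p ≤ lvl (f.toFun p.2) := fun p => by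
    have := p.1.2.1
    have := gp_le_left (f.toFun p.2) (g.toFun p.2)
    simp only [c]
    nlinarith
  have le_c : ∀ p, gp (f.toFun p.2) (g.toFun p.2) ≤ c p := fun p => by
    have := p.1.2.2
    have := gp_le_left (f.toFun p.2) (g.toFun p.2)
    simp only [c]
    nlinarith
  have c_nonneg : ∀ p, 0 ≤ c p := fun p => (gp_nonneg _ _).trans (le_c p)
  let H : unitInterval × S.Space → T.Space := fun p => anc (c p) (f.toFun p.2)
  have lvl_H : ∀ p, lvl (H p) = c p := fun p => lvl_anc_of_le (c_nonneg p) (c_le p)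
  have hlip : ∀ t, LipschitzWith 1 fun x => H (t, x) := fun t =>
    LipschitzWith.of_dist_le_mul fun x y => by
      rw [NNReal.coe_one, one_mul]
      refine dist_anc_convex_le t.2.1 t.2.2 (gp_nonneg _ _) (gp_nonneg _ _) (gp_le_left _ _)
        (gp_le_left _ _) (f.dist_le x y) (abs_sub_le_iff.2 ⟨?_, ?_⟩)
      · refine (gp_sub_le _ _ _ _).trans (max_le ?_ ?_) <;> rw [dist_comm x]
        exacts [f.dist_le y x, g.dist_le y x]
      · exact (gp_sub_le _ _ _ _).trans (max_le (f.dist_le x y) (g.dist_le x y))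
  have hcont : Continuous H := by
    -- Uniform Lipschitz control in `x` reduces joint continuity to continuity in the time variable
    -- alone.
    refine continuous_prod_of_continuous_lipschitzWith' H 1 hlip fun x => ?_
    have hc : Continuous fun t : unitInterval => c (t, x) := by
      simp only [c]
      fun_prop
    exact continuous_anc hc (fun t => c_nonneg (t, x)) (f.toFun x)
  refine ⟨⟨⟨H, hcont⟩, fun x => ?_, fun x => ?_⟩, fun t => ?_, fun M hM => ?_, hlip⟩
  · refine anc_of_lvl_le (le_of_eq ?_)
    simp [c]
  · change anc _ _ = anc _ _
    congr 1
    simp [c]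
  · refine eq_base ((lvl_H _).trans (le_antisymm ((c_le _).trans (le_of_eq ?_)) (c_nonneg _)))
    rw [f.map_root]
    exact lvl_base
  · obtain ⟨n, hn⟩ := exists_nat_ge M
    obtain ⟨N, hN⟩ := h n
    refine ⟨N + 1, by positivity, fun t x hx => ?_⟩
    rw [Metric.mem_ball'] at hx ⊢
    change lvl (H (t, x)) < M at hx
    rw [lvl_H] at hx
    by_contra hlt
    have h1 : (N : ℝ) + 1 ≤ lvl x := not_lt.1 hlt
    have := hN x (by linarith)
    have := le_c (t, x)
    simp only at this
    linarith

/-- Two non-expansive maps are homotopic if and only if they are close. -/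
lemma homotopic_iff_close {f g : NEMap S T} : f.Homotopic g ↔ f.Close g := by
  refine ⟨Homotopic.close, fun h => ?_⟩
  have h2 := h.symm.homotopic_meet
  rw [← meet_comm h] at h2
  exact (equivalence S T).trans h.homotopic_meet ((equivalence S T).symm h2)

end NEMap

/-! ### The tower of spheres -/

/-- The inverse sequence of the spheres around the root, with the ancestor maps. -/
noncomputable def sphereTower (S : RootedSimplicialTree.{u}) : TowerSet.{u} where
  sys :=
    { obj := fun n => {x : S.Space // lvl x = (n.unop : ℝ)}
      map := fun {m n} h => TypeCat.ofHom fun x => ⟨anc (n.unop : ℝ) x.1,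
        lvl_anc_of_le (Nat.cast_nonneg _) (x.2.symm ▸ Nat.cast_le.2 (leOfHom h.unop))⟩
      map_id := fun n => by
        ext x
        exact anc_of_lvl_le x.2.le
      map_comp := fun {m n k} h h' => by
        ext x
        exact (anc_anc_of_le (Nat.cast_nonneg _) (Nat.cast_le.2 (leOfHom h'.unop)) x.1).symm }

/-- A point at integral distance from the root as a member of the tower of spheres. -/
def toTerm {n : ℕ} (x : S.Space) (h : lvl x = n) : (sphereTower S).term n := ⟨x, h⟩

/-- A member of the tower of spheres as a point. -/
def ofTerm {n : ℕ} (x : (sphereTower S).term n) : S.Space := x.1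

lemma lvl_ofTerm {n : ℕ} (x : (sphereTower S).term n) : lvl (ofTerm x) = n := x.2

lemma ofTerm_injective {n : ℕ} : Function.Injective (ofTerm (S := S) (n := n)) :=
  fun _ _ h => Subtype.ext h

@[simp] lemma ofTerm_bond {n m : ℕ} (h : n ≤ m) (x : (sphereTower S).term m) :
    ofTerm ((sphereTower S).bond h x) = anc (n : ℝ) (ofTerm x) := rfl

lemma term_hom_ext {A : Type u} {n : ℕ} {f g : A ⟶ (sphereTower S).term n}
    (h : ∀ x, ofTerm (f x) = ofTerm (g x)) : f = g := by
  ext x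
  exact ofTerm_injective (h x)

namespace NEMap

/-- `Φ` is a modulus of properness for `f`. -/
def IsModulus (f : NEMap S T) (Φ : ℕ → ℕ) : Prop :=
  ∀ n x, (Φ n : ℝ) ≤ lvl x → (n : ℝ) < lvl (f.toFun x)

lemma exists_isModulus (f : NEMap S T) : ∃ Φ, f.IsModulus Φ := by
  choose Φ hΦ using metricallyProper_iff.1 f.proper
  exact ⟨Φ, hΦ⟩

/-- The segment from `x` to its ancestor stays beyond radius `Φ n`, so its image stays above height
`n` and keeps the same ancestor there. -/
lemma IsModulus.anc_eq {f : NEMap S T} {Φ : ℕ → ℕ} (hΦ : f.IsModulus Φ) {n : ℕ} {x : S.Space}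
    (hx : (Φ n : ℝ) ≤ lvl x) {s : ℝ} (hs : (Φ n : ℝ) ≤ s) :
    anc (n : ℝ) (f.toFun (anc s x)) = anc (n : ℝ) (f.toFun x) := by
  have h0 : (0 : ℝ) ≤ Φ n := Nat.cast_nonneg _
  rw [anc_eq_anc_iff (Nat.cast_nonneg _) (hΦ n _ ?_).le (hΦ n _ hx).le]
  · exact le_gp_comp_anc f.nonexpansive.continuous h0 (hΦ n) hx hs
  · rw [lvl_anc (h0.trans hs)]
    exact le_min hs hx

/-- The morphism of sequences induced by a non-expansive map on spheres. -/
noncomputable def preHom (f : NEMap S T) {Φ : ℕ → ℕ} (hΦ : f.IsModulus Φ) :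
    Tower.PreHom (sphereTower S) (sphereTower T) where
  idx := Φ
  app n := TypeCat.ofHom fun x => toTerm (anc (n : ℝ) (f.toFun (ofTerm x)))
    (lvl_anc_of_le (Nat.cast_nonneg _) (hΦ n _ (lvl_ofTerm x).ge).le)
  compat n n' h := by
    refine ⟨max (Φ n) (Φ n'), le_max_left _ _, le_max_right _ _, term_hom_ext fun x => ?_⟩
    have h1 : ((Φ n : ℕ) : ℝ) ≤ lvl (ofTerm x) := by
      rw [lvl_ofTerm]; exact_mod_cast le_max_left _ _
    have h2 : ((Φ n' : ℕ) : ℝ) ≤ lvl (ofTerm x) := by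
      rw [lvl_ofTerm]; exact_mod_cast le_max_right _ _
    change anc (n : ℝ) (f.toFun (anc (Φ n : ℝ) (ofTerm x))) =
      anc (n : ℝ) (anc (n' : ℝ) (f.toFun (anc (Φ n' : ℝ) (ofTerm x))))
    rw [hΦ.anc_eq h1 le_rfl, hΦ.anc_eq h2 le_rfl,
      anc_anc_of_le (Nat.cast_nonneg _) (Nat.cast_le.2 h.le)]

/-- By `IsModulus.anc_eq`, both sides say that `f x` and `g x` have the same ancestor at height `n`
once `x` is far out. The case `f = g` shows that the choice of modulus does not affect the class. -/
lemma preHom_equiv_iff {f g : NEMap S T} {Φ Ψ : ℕ → ℕ} (hΦ : f.IsModulus Φ)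
    (hΨ : g.IsModulus Ψ) : (f.preHom hΦ).Equiv (g.preHom hΨ) ↔ f.Close g := by
  have key : ∀ n x, (Φ n : ℝ) ≤ lvl x → (Ψ n : ℝ) ≤ lvl x →
      (anc (n : ℝ) (f.toFun x) = anc (n : ℝ) (g.toFun x) ↔
        (n : ℝ) ≤ gp (f.toFun x) (g.toFun x)) := fun n x h1 h2 =>
    anc_eq_anc_iff (Nat.cast_nonneg _) (hΦ n x h1).le (hΨ n x h2).le
  constructor
  · intro h n
    obtain ⟨m, h1, h2, e⟩ := h n
    change Φ n ≤ m at h1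
    change Ψ n ≤ m at h2
    have h1' : (Φ n : ℝ) ≤ m := Nat.cast_le.2 h1
    have h2' : (Ψ n : ℝ) ≤ m := Nat.cast_le.2 h2
    refine ⟨m, fun x hx => (key n x (h1'.trans hx) (h2'.trans hx)).1 ?_⟩
    have := congrArg (fun φ : (sphereTower S).term m ⟶ (sphereTower T).term n =>
      ofTerm (φ (toTerm (anc (m : ℝ) x) (lvl_anc_of_le (Nat.cast_nonneg _) hx)))) e
    change anc (n : ℝ) (f.toFun (anc (Φ n : ℝ) (anc (m : ℝ) x))) =
      anc (n : ℝ) (g.toFun (anc (Ψ n : ℝ) (anc (m : ℝ) x))) at this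
    rwa [anc_anc_of_le (Nat.cast_nonneg _) h1', anc_anc_of_le (Nat.cast_nonneg _) h2',
      hΦ.anc_eq (h1'.trans hx) le_rfl, hΨ.anc_eq (h2'.trans hx) le_rfl] at this
  · intro h n
    obtain ⟨N, hN⟩ := h n
    refine ⟨max N (max (Φ n) (Ψ n)), (le_max_left _ _).trans (le_max_right _ _),
      (le_max_right _ _).trans (le_max_right _ _), term_hom_ext fun x => ?_⟩
    have h0 : (N : ℝ) ≤ lvl (ofTerm x) := by
      rw [lvl_ofTerm]; exact_mod_cast le_max_left _ _
    have h1 : ((Φ n : ℕ) : ℝ) ≤ lvl (ofTerm x) := by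
      rw [lvl_ofTerm]; exact_mod_cast (le_max_left _ _).trans (le_max_right _ _)
    have h2 : ((Ψ n : ℕ) : ℝ) ≤ lvl (ofTerm x) := by
      rw [lvl_ofTerm]; exact_mod_cast (le_max_right _ _).trans (le_max_right _ _)
    change anc (n : ℝ) (f.toFun (anc (Φ n : ℝ) (ofTerm x))) =
      anc (n : ℝ) (g.toFun (anc (Ψ n : ℝ) (ofTerm x)))
    rw [hΦ.anc_eq h1 le_rfl, hΨ.anc_eq h2 le_rfl]
    exact (key n _ h1 h2).2 (hN _ h0)

/-- The moduli are arbitrary because those chosen by `sphereFunctor` need not be compatible with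
composition. -/
lemma preHom_comp_equiv {f : NEMap S T} {g : NEMap T U} {Φ Ψ χ : ℕ → ℕ} (hΦ : f.IsModulus Φ)
    (hΨ : g.IsModulus Ψ) (hχ : (f.comp g).IsModulus χ) :
    ((f.comp g).preHom hχ).Equiv ((f.preHom hΦ).comp (g.preHom hΨ)) := by
  intro n
  have hΦΨ : (f.comp g).IsModulus (fun n => Φ (Ψ n)) := fun n x hx => hΨ n _ (hΦ _ x hx).le
  refine ⟨max (χ n) (Φ (Ψ n)), le_max_left _ _, le_max_right _ _, term_hom_ext fun x => ?_⟩
  have h1 : ((χ n : ℕ) : ℝ) ≤ lvl (ofTerm x) := by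
    rw [lvl_ofTerm]; exact_mod_cast le_max_left _ _
  have h2 : ((Φ (Ψ n) : ℕ) : ℝ) ≤ lvl (ofTerm x) := by
    rw [lvl_ofTerm]; exact_mod_cast le_max_right _ _
  change anc (n : ℝ) ((f.comp g).toFun (anc (χ n : ℝ) (ofTerm x))) =
    anc (n : ℝ) (g.toFun (anc (Ψ n : ℝ) (f.toFun (anc (Φ (Ψ n) : ℝ) (ofTerm x)))))
  rw [hχ.anc_eq h1 le_rfl, hΨ.anc_eq ?_ le_rfl]
  · exact (hΦΨ.anc_eq h2 le_rfl).symm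
  · refine (hΦ _ _ ?_).le
    rw [lvl_anc_of_le (Nat.cast_nonneg _) h2]

lemma preHom_id_equiv {Φ : ℕ → ℕ} (hΦ : (NEMap.id S).IsModulus Φ) :
    ((NEMap.id S).preHom hΦ).Equiv (Tower.PreHom.id _) := by
  intro n
  refine ⟨max (Φ n) n, le_max_left _ _, le_max_right _ _, term_hom_ext fun x => ?_⟩
  have h1 : ((Φ n : ℕ) : ℝ) ≤ lvl (ofTerm x) := by
    rw [lvl_ofTerm]; exact_mod_cast le_max_left _ _
  exact hΦ.anc_eq h1 le_rfl

end NEMap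

/-- The functor sending a rooted tree to its tower of spheres. -/
noncomputable def sphereFunctor : RootedSimplicialTree.{u} ⥤ TowerSet.{u} where
  obj := sphereTower
  map := Quotient.map (fun f => f.preHom f.exists_isModulus.choose_spec) fun f g h =>
    (NEMap.preHom_equiv_iff _ _).2 (NEMap.homotopic_iff_close.1 h)
  map_id S := Quotient.sound (NEMap.preHom_id_equiv _)
  map_comp := by
    rintro S T U ⟨f⟩ ⟨g⟩
    exact Quotient.sound (NEMap.preHom_comp_equiv _ _ _)

instance : sphereFunctor.{u}.Faithful where
  map_injective := by
    rintro S T ⟨f⟩ ⟨g⟩ h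
    exact Quotient.sound (NEMap.homotopic_iff_close.2
      ((NEMap.preHom_equiv_iff _ _).1 (Quotient.exact h)))

end RootedSimplicialTree

/-! ### Realizing a morphism of towers by a non-expansive map -/

/-- A slowly growing function, at most `k` on `[0, m (k + 1)]`. -/
noncomputable def slowGrowth (m : ℕ → ℕ) (r : ℝ) : ℝ := ⨅ k : ℕ, ((k : ℝ) + max 0 (r - m (k + 1)))

section SlowGrowth

variable (m : ℕ → ℕ)

lemma slowGrowth_bddBelow (r : ℝ) :
    BddBelow (Set.range fun k : ℕ => (k : ℝ) + max 0 (r - m (k + 1))) :=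
  ⟨0, by rintro _ ⟨k, rfl⟩; positivity⟩

lemma slowGrowth_nonneg (r : ℝ) : 0 ≤ slowGrowth m r := le_ciInf fun k => by positivity

lemma slowGrowth_le {r : ℝ} {k : ℕ} (h : r ≤ m (k + 1)) : slowGrowth m r ≤ k := by
  refine (ciInf_le (slowGrowth_bddBelow m r) k).trans ?_
  rw [max_eq_left (by linarith), add_zero]

lemma slowGrowth_mono {r s : ℝ} (h : r ≤ s) : slowGrowth m r ≤ slowGrowth m s :=
  ciInf_mono (slowGrowth_bddBelow m r) fun k => by gcongr

lemma slowGrowth_le_add {r s : ℝ} (h : r ≤ s) :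
    slowGrowth m s ≤ slowGrowth m r + (s - r) := by
  rw [← sub_le_iff_le_add]
  refine le_ciInf fun k => ?_
  have h1 := ciInf_le (slowGrowth_bddBelow m s) k
  have h2 : max 0 (s - m (k + 1)) ≤ max 0 (r - m (k + 1)) + (s - r) :=
    max_le (by have := le_max_left 0 (r - m (k + 1)); linarith)
      (by have := le_max_right 0 (r - m (k + 1)); linarith)
  change slowGrowth m s ≤ _ at h1
  linarith

lemma exists_le_slowGrowth (hm : Monotone m) (n : ℕ) :
    ∃ N : ℕ, ∀ r : ℝ, (N : ℝ) ≤ r → (n : ℝ) ≤ slowGrowth m r := by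
  -- In the infimum, the terms with `k ≥ n` are at least `n` through their first summand, those with
  -- `k ≤ n` through `r - m (k + 1) ≥ n`.
  refine ⟨n + m (n + 1), fun r hr => le_ciInf fun k => ?_⟩
  push_cast at hr
  rcases le_total n k with h | h
  · have h1 : (n : ℝ) ≤ k := Nat.cast_le.2 h
    linarith [le_max_left 0 (r - m (k + 1))]
  · have h1 : (m (k + 1) : ℝ) ≤ m (n + 1) := Nat.cast_le.2 (hm (by omega))
    have := le_max_right 0 (r - m (k + 1))
    have : (0 : ℝ) ≤ k := Nat.cast_nonneg k
    linarith

end SlowGrowth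

namespace RootedSimplicialTree

open RootedRTree

variable {S T : RootedSimplicialTree.{u}}

/-- A family of maps `g k`, defined at distance at least `m k` from the root with values at distance
`k` from the root, that depend only on the ancestor at distance `m k` and are compatible with taking
ancestors. -/
structure CoherentFamily (S T : RootedSimplicialTree.{u}) where
  /-- the radii beyond which the maps are defined -/
  radius : ℕ → ℕ
  strictMono : StrictMono radius
  /-- the maps -/
  map : ℕ → S.Space → T.Space
  lvl_map : ∀ k x, (radius k : ℝ) ≤ lvl x → lvl (map k x) = k
  map_anc : ∀ k x s, (radius k : ℝ) ≤ lvl x → (radius k : ℝ) ≤ s → map k (anc s x) = map k x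
  anc_map : ∀ k x, (radius (k + 1) : ℝ) ≤ lvl x → anc (k : ℝ) (map (k + 1) x) = map k x

namespace CoherentFamily

variable (A : CoherentFamily S T)

lemma anc_map_le {j k : ℕ} (hjk : j ≤ k) {x : S.Space} (hx : (A.radius k : ℝ) ≤ lvl x) :
    anc (j : ℝ) (A.map k x) = A.map j x := by
  induction k, hjk using Nat.le_induction with
  | base => exact anc_of_lvl_le (A.lvl_map _ _ hx).le
  | succ k hjk ih =>
    have h : (A.radius k : ℝ) ≤ A.radius (k + 1) := Nat.cast_le.2 (A.strictMono.monotone k.le_succ)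
    rw [← ih (h.trans hx), ← A.anc_map k x hx, anc_anc_of_le (Nat.cast_nonneg _)
      (Nat.cast_le.2 hjk)]

lemma exists_stage (r : ℝ) : ∃ k : ℕ, r ≤ A.radius (k + 1) := by
  obtain ⟨n, hn⟩ := exists_nat_ge r
  exact ⟨n, hn.trans (Nat.cast_le.2 (n.le_succ.trans (A.strictMono.id_le (n + 1))))⟩

/-- The index of the map used at distance `r` from the root. -/
noncomputable def stage (r : ℝ) : ℕ :=
  open Classical in Nat.find (A.exists_stage r)

lemma le_radius_stage (r : ℝ) : r ≤ A.radius (A.stage r + 1) := by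
  classical exact Nat.find_spec (A.exists_stage r)

lemma stage_mono {r s : ℝ} (h : r ≤ s) : A.stage r ≤ A.stage s := by
  classical exact Nat.find_min' (A.exists_stage r) (h.trans (A.le_radius_stage s))

lemma radius_stage_le {r : ℝ} (h : A.stage r ≠ 0) : (A.radius (A.stage r) : ℝ) ≤ r := by
  classical
  obtain ⟨k, hk⟩ := Nat.exists_eq_succ_of_ne_zero h
  have : ¬ r ≤ A.radius (k + 1) := Nat.find_min (A.exists_stage r) (by
    change k < A.stage r
    omega)
  rw [hk]
  exact (not_le.1 this).le

lemma slowGrowth_le_stage (r : ℝ) : slowGrowth A.radius r ≤ A.stage r :=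
  slowGrowth_le _ (A.le_radius_stage r)

lemma slowGrowth_of_stage_eq_zero {r : ℝ} (h : A.stage r = 0) : slowGrowth A.radius r = 0 := by
  have := A.slowGrowth_le_stage r
  rw [h, Nat.cast_zero] at this
  exact le_antisymm this (slowGrowth_nonneg _ _)

/-- The union of the maps of a coherent family. -/
noncomputable def union (x : S.Space) : T.Space := A.map (A.stage (lvl x)) x

lemma slowGrowth_le_lvl_union (x : S.Space) : slowGrowth A.radius (lvl x) ≤ lvl (A.union x) := by
  -- At stage `0` the point may lie inside the radius of `map 0`, where its value is uncontrolled;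
  -- there `slowGrowth` vanishes and the value is irrelevant.
  by_cases h : A.stage (lvl x) = 0
  · rw [A.slowGrowth_of_stage_eq_zero h]
    exact lvl_nonneg _
  · rw [union, A.lvl_map _ _ (A.radius_stage_le h)]
    exact A.slowGrowth_le_stage _

lemma anc_union {x : S.Space} {n : ℕ} (hn : n ≤ A.stage (lvl x)) (h : A.stage (lvl x) ≠ 0) :
    anc (n : ℝ) (A.union x) = A.map n x :=
  A.anc_map_le hn (A.radius_stage_le h)

/-- Put `k = A.stage (gp x y)`. If `k` is nonzero, `map k` factors through the common ancestor of
`x` and `y` at height `gp x y`, so the two images share their ancestor at height `k`. -/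
lemma slowGrowth_le_gp_union (x y : S.Space) :
    slowGrowth A.radius (gp x y) ≤ gp (A.union x) (A.union y) := by
  by_cases h : A.stage (gp x y) = 0
  · rw [A.slowGrowth_of_stage_eq_zero h]
    exact gp_nonneg _ _
  · refine (A.slowGrowth_le_stage _).trans ?_
    have hc := A.radius_stage_le h
    have h1 := A.stage_mono (gp_le_left x y)
    have h2 := A.stage_mono (gp_le_right x y)
    have h1' : A.stage (lvl x) ≠ 0 := by omega
    have h2' : A.stage (lvl y) ≠ 0 := by omega
    rw [← anc_eq_anc_iff (Nat.cast_nonneg _), A.anc_union h1 h1', A.anc_union h2 h2',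
      ← A.map_anc _ x _ (hc.trans (gp_le_left x y)) hc,
      ← A.map_anc _ y _ (hc.trans (gp_le_right x y)) hc,
      (anc_eq_anc_iff (gp_nonneg x y) (gp_le_left x y) (gp_le_right x y)).2 le_rfl]
    · rw [union, A.lvl_map _ _ (A.radius_stage_le h1')]
      exact Nat.cast_le.2 h1
    · rw [union, A.lvl_map _ _ (A.radius_stage_le h2')]
      exact Nat.cast_le.2 h2

/-- The non-expansive map that realizes a coherent family. -/
noncomputable def toNEMap : NEMap S T where
  toFun x := anc (slowGrowth A.radius (lvl x)) (A.union x)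
  map_root := by
    have : slowGrowth A.radius (lvl S.root) = 0 := by
      refine le_antisymm ?_ (slowGrowth_nonneg _ _)
      have h0 : lvl S.root = 0 := lvl_base
      rw [h0, ← Nat.cast_zero]
      exact slowGrowth_le _ (Nat.cast_le.2 (Nat.zero_le _))
    rw [this, anc_zero]
    rfl
  proper := metricallyProper_iff.2 fun n => by
    obtain ⟨N, hN⟩ := exists_le_slowGrowth A.radius A.strictMono.monotone (n + 1)
    refine ⟨N, fun x hx => ?_⟩
    rw [lvl_anc_of_le (slowGrowth_nonneg _ _) (A.slowGrowth_le_lvl_union x)]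
    have := hN _ hx
    push_cast at this
    linarith
  nonexpansive := LipschitzWith.of_dist_le_mul fun x y => by
    rw [NNReal.coe_one, one_mul]
    refine dist_anc_anc_le (slowGrowth_nonneg _ _) (slowGrowth_nonneg _ _)
      (A.slowGrowth_le_lvl_union x) (A.slowGrowth_le_lvl_union y) ?_ ?_
    · have h := abs_le.1 (lvl_sub_le x y)
      rw [abs_sub_le_iff]
      rcases le_total (lvl x) (lvl y) with h' | h'
      · have h1 := slowGrowth_mono A.radius h'
        have h2 := slowGrowth_le_add A.radius h'
        constructor <;> linarith
      · have h1 := slowGrowth_mono A.radius h'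
        have h2 := slowGrowth_le_add A.radius h'
        constructor <;> linarith
    · have h1 := slowGrowth_le_add A.radius (gp_le_left x y)
      have h2 := slowGrowth_le_add A.radius (gp_le_right x y)
      have h3 := A.slowGrowth_le_gp_union x y
      have h4 := dist_eq x y
      linarith

lemma anc_toNEMap {n : ℕ} {x : S.Space} (h : (n : ℝ) < lvl (A.toNEMap.toFun x)) :
    anc (n : ℝ) (A.toNEMap.toFun x) = A.map n x := by
  change (n : ℝ) < lvl (anc _ _) at h
  rw [lvl_anc_of_le (slowGrowth_nonneg _ _) (A.slowGrowth_le_lvl_union x)] at h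
  have h1 : n < A.stage (lvl x) := Nat.cast_lt.1 (h.trans_le (A.slowGrowth_le_stage _))
  change anc (n : ℝ) (anc _ _) = _
  rw [anc_anc_of_le (Nat.cast_nonneg _) h.le, A.anc_union h1.le (by omega)]

end CoherentFamily

/-- The maps of a morphism of towers of spheres, extended to all points far from the root. -/
noncomputable def extendApp (α : Tower.PreHom (sphereTower S) (sphereTower T)) (k : ℕ)
    (x : S.Space) : T.Space :=
  open Classical in
  if h : (α.idx k : ℝ) ≤ lvl x then
    ofTerm (α.app k (toTerm (anc (α.idx k : ℝ) x) (lvl_anc_of_le (Nat.cast_nonneg _) h)))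
  else base

lemma extendApp_of_le (α : Tower.PreHom (sphereTower S) (sphereTower T)) {k : ℕ} {x : S.Space}
    (h : (α.idx k : ℝ) ≤ lvl x) : extendApp α k x =
      ofTerm (α.app k (toTerm (anc (α.idx k : ℝ) x) (lvl_anc_of_le (Nat.cast_nonneg _) h))) :=
  dif_pos h

lemma extendApp_anc (α : Tower.PreHom (sphereTower S) (sphereTower T)) {k : ℕ} {x : S.Space}
    {s : ℝ} (h : (α.idx k : ℝ) ≤ lvl x) (hs : (α.idx k : ℝ) ≤ s) :
    extendApp α k (anc s x) = extendApp α k x := by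
  have h0 : (0 : ℝ) ≤ α.idx k := Nat.cast_nonneg _
  have h' : (α.idx k : ℝ) ≤ lvl (anc s x) := by
    rw [lvl_anc (h0.trans hs)]
    exact le_min hs h
  rw [extendApp_of_le α h, extendApp_of_le α h']
  congr 3
  exact anc_anc_of_le h0 hs x

lemma exists_anc_extendApp (α : Tower.PreHom (sphereTower S) (sphereTower T)) (k : ℕ) :
    ∃ M : ℕ, ∀ x, (M : ℝ) ≤ lvl x → anc (k : ℝ) (extendApp α (k + 1) x) = extendApp α k x := by
  obtain ⟨M, h1, h2, e⟩ := α.compat k (k + 1) k.lt_succ_self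
  refine ⟨M, fun x hx => ?_⟩
  have h1' : (α.idx k : ℝ) ≤ M := Nat.cast_le.2 h1
  have h2' : (α.idx (k + 1) : ℝ) ≤ M := Nat.cast_le.2 h2
  have hM : lvl (anc (M : ℝ) x) = M := lvl_anc_of_le (Nat.cast_nonneg _) hx
  rw [← extendApp_anc α (h1'.trans hx) h1', ← extendApp_anc α (h2'.trans hx) h2',
    extendApp_of_le α (h1'.trans hM.ge), extendApp_of_le α (h2'.trans hM.ge)]
  exact (congrArg (fun φ : (sphereTower S).term M ⟶ (sphereTower T).term k =>
    ofTerm (φ (toTerm (anc (M : ℝ) x) hM))) e).symm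

lemma exists_coherentFamily (α : Tower.PreHom (sphereTower S) (sphereTower T)) :
    ∃ A : CoherentFamily S T, A.map = extendApp α := by
  choose M hM using exists_anc_extendApp α
  let m : ℕ → ℕ := fun k => ∑ i ∈ Finset.range (k + 1), (α.idx i + M i + 1)
  have idx_le : ∀ k, (α.idx k : ℝ) ≤ m k := fun k => Nat.cast_le.2 <| by
    simp only [m, Finset.sum_range_succ]
    omega
  have M_le : ∀ k, (M k : ℝ) ≤ m (k + 1) := fun k => Nat.cast_le.2 <| by
    simp only [m, Finset.sum_range_succ]
    omega
  refine ⟨⟨m, strictMono_nat_of_lt_succ fun k => ?_, extendApp α, fun k x hx => ?_,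
    fun k x s hx hs => ?_, fun k x hx => ?_⟩, rfl⟩
  · simp only [m]
    rw [Finset.sum_range_succ _ (k + 1)]
    omega
  · rw [extendApp_of_le α ((idx_le k).trans hx), lvl_ofTerm]
  · exact extendApp_anc α ((idx_le k).trans hx) ((idx_le k).trans hs)
  · exact hM k x ((M_le k).trans hx)

lemma CoherentFamily.preHom_equiv (A : CoherentFamily S T)
    {α : Tower.PreHom (sphereTower S) (sphereTower T)} (hA : A.map = extendApp α) {Φ : ℕ → ℕ}
    (hΦ : A.toNEMap.IsModulus Φ) : (A.toNEMap.preHom hΦ).Equiv α := by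
  intro n
  refine ⟨max (Φ n) (α.idx n), le_max_left _ _, le_max_right _ _, term_hom_ext fun x => ?_⟩
  have h1 : ((Φ n : ℕ) : ℝ) ≤ lvl (ofTerm x) := by
    rw [lvl_ofTerm]; exact_mod_cast le_max_left _ _
  have h2 : ((α.idx n : ℕ) : ℝ) ≤ lvl (ofTerm x) := by
    rw [lvl_ofTerm]; exact_mod_cast le_max_right _ _
  change anc (n : ℝ) (A.toNEMap.toFun (anc (Φ n : ℝ) (ofTerm x))) = _
  rw [hΦ.anc_eq h1 le_rfl, A.anc_toNEMap (hΦ _ _ h1), hA, extendApp_of_le α h2]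
  rfl

instance : sphereFunctor.{u}.Full where
  map_surjective := by
    rintro S T ⟨α⟩
    obtain ⟨A, hA⟩ := exists_coherentFamily α
    exact ⟨⟦A.toNEMap⟧, Quotient.sound (A.preHom_equiv hA _)⟩

end RootedSimplicialTree

/-! ### Trees from parent functions -/

namespace SimpleGraph

variable {V : Type u}

/-- The graph in which every vertex other than `o` is joined to its parent. -/
def parentGraph (o : V) (par : V → V) (δ : V → ℕ) (hδ : ∀ a, a ≠ o → δ (par a) + 1 = δ a) :
    SimpleGraph V where
  Adj a b := (a ≠ o ∧ par a = b) ∨ (b ≠ o ∧ par b = a)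
  symm := ⟨fun a b h => h.symm⟩
  loopless := ⟨fun a h => by
    have key : a ≠ o → par a ≠ a := fun h1 h2 => by
      have := hδ a h1
      rw [h2] at this
      omega
    rcases h with h | h <;> exact key h.1 h.2⟩

variable {o : V} {par : V → V} {δ : V → ℕ} (hδ : ∀ a, a ≠ o → δ (par a) + 1 = δ a)

lemma parentGraph_adj_parent {a : V} (h : a ≠ o) : (parentGraph o par δ hδ).Adj (par a) a :=
  Or.inr ⟨h, rfl⟩

lemma parentGraph_exists_walk (a : V) :
    ∃ w : (parentGraph o par δ hδ).Walk a o, w.length ≤ δ a := by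
  induction h : δ a generalizing a with
  | zero =>
    have : a = o := by
      by_contra h'
      have := hδ a h'
      omega
    subst this
    exact ⟨.nil, by simp⟩
  | succ n ih =>
    by_cases h' : a = o
    · subst h'
      exact ⟨.nil, by simp⟩
    · obtain ⟨w, hw⟩ := ih (par a) (by have := hδ a h'; omega)
      exact ⟨.cons (parentGraph_adj_parent hδ h').symm w, by simpa using hw⟩

lemma parentGraph_depth_le {a b : V} (w : (parentGraph o par δ hδ).Walk a b) :
    δ a ≤ δ b + w.length := by
  induction w with
  | nil => simp
  | cons h _ ih =>
    rw [Walk.length_cons]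
    rcases h with ⟨h, rfl⟩ | ⟨h, rfl⟩
    · have := hδ _ h
      omega
    · have := hδ _ h
      omega

lemma parentGraph_connected : (parentGraph o par δ hδ).Connected := by
  have : Nonempty V := ⟨o⟩
  refine ⟨fun a b => ?_⟩
  obtain ⟨w, -⟩ := parentGraph_exists_walk hδ a
  obtain ⟨w', -⟩ := parentGraph_exists_walk hδ b
  exact (w.append w'.reverse).reachable

lemma parentGraph_dist (h0 : δ o = 0) (a : V) : (parentGraph o par δ hδ).dist o a = δ a := by
  rw [dist_comm]
  apply le_antisymm
  · obtain ⟨w, hw⟩ := parentGraph_exists_walk hδ a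
    exact (dist_le w).trans hw
  · obtain ⟨w, hw⟩ := ((parentGraph_connected hδ) a o).exists_walk_length_eq_dist
    have := parentGraph_depth_le hδ w
    omega

lemma parentGraph_isBridge {a : V} (ha : a ≠ o) :
    ¬ ((parentGraph o par δ hδ).deleteEdges {s(a, par a)}).Reachable a (par a) := by
  have key : ∀ {b c : V}, ((parentGraph o par δ hδ).deleteEdges {s(a, par a)}).Walk b c →
      (∃ k, par^[k] b = a ∧ ∀ j ≤ k, par^[j] b ≠ o) → ∃ k, par^[k] c = a ∧ ∀ j ≤ k, par^[j] c ≠ o := by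
    intro b c w
    induction w with
    | nil => exact fun h => h
    | @cons b b' c h w ih =>
      rintro ⟨k, hk, hk'⟩
      apply ih
      rw [deleteEdges_adj] at h
      rcases h with ⟨⟨h1, rfl⟩ | ⟨h1, rfl⟩, h2⟩
      · cases k with
        | zero =>
          exfalso
          apply h2
          obtain rfl : b = a := hk
          rfl
        | succ k => exact ⟨k, hk, fun j hj => hk' (j + 1) (by omega)⟩
      · refine ⟨k + 1, hk, fun j hj => ?_⟩
        cases j with
        | zero => exact h1
        | succ j => exact hk' j (by omega)
  have depth_le : ∀ k c, (∀ j ≤ k, par^[j] c ≠ o) → δ (par^[k] c) ≤ δ c := by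
    intro k
    induction k with
    | zero => exact fun c _ => le_rfl
    | succ k ih =>
      intro c hc
      have h1 := hδ c (hc 0 (Nat.zero_le _))
      have h2 := ih (par c) fun j hj => hc (j + 1) (by omega)
      rw [Function.iterate_succ_apply]
      omega
  rintro ⟨w⟩
  obtain ⟨k, hk, hk'⟩ := key w ⟨0, rfl, fun j hj => by
    rw [Nat.le_zero.1 hj]
    exact ha⟩
  have h1 := depth_le k _ hk'
  have h2 := hδ a ha
  rw [hk] at h1
  omega

lemma parentGraph_isTree : (parentGraph o par δ hδ).IsTree := by
  refine ⟨parentGraph_connected hδ, isAcyclic_iff_forall_adj_isBridge.2 fun a b h => ?_⟩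
  rcases h with ⟨h, rfl⟩ | ⟨h, rfl⟩
  · exact isBridge_iff.2 (parentGraph_isBridge hδ h)
  · rw [Sym2.eq_swap]
    exact isBridge_iff.2 (parentGraph_isBridge hδ h)

end SimpleGraph

/-! ### The tree of a tower -/

namespace Tower

open RootedRTree RootedSimplicialTree

variable (X : TowerSet.{u})

/-- The parent function of the tree of a tower; the root is `none`. -/
noncomputable def treeParent : Option (Σ n, X.term n) → Option (Σ n, X.term n)
  | some ⟨n + 1, x⟩ => some ⟨n, X.bond n.le_succ x⟩
  | _ => none

/-- The depth of a vertex of the tree of a tower. -/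
def treeDepth : Option (Σ n, X.term n) → ℕ
  | some ⟨n, _⟩ => n + 1
  | none => 0

lemma treeDepth_parent (a : Option (Σ n, X.term n)) (h : a ≠ none) :
    treeDepth X (treeParent X a) + 1 = treeDepth X a := by
  match a, h with
  | some ⟨0, x⟩, _ => rfl
  | some ⟨n + 1, x⟩, _ => rfl

/-- The tree of a tower. -/
noncomputable def tree : RootedSimplicialTree.{u} where
  V := Option (Σ n, X.term n)
  graph := SimpleGraph.parentGraph none (treeParent X) (treeDepth X) (treeDepth_parent X)
  isTree := SimpleGraph.parentGraph_isTree _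
  rootVertex := none

/-- The vertex of the tree of a tower given by a member of its `n`-th set. -/
def treeVertex {n : ℕ} (x : X.term n) : (tree X).V := some ⟨n, x⟩

/-- The point of the tree of a tower given by a member of its `n`-th set. -/
noncomputable def node {n : ℕ} (x : X.term n) : (tree X).Space := (tree X).vertex (treeVertex X x)

lemma depth_tree (a : (tree X).V) : (tree X).depth a = treeDepth X a :=
  SimpleGraph.parentGraph_dist (treeDepth_parent X) rfl a

@[simp] lemma depth_treeVertex {n : ℕ} (x : X.term n) :
    (tree X).depth (treeVertex X x) = n + 1 := depth_tree X _

lemma lvl_node {n : ℕ} (x : X.term n) : lvl (node X x) = (n + 1 : ℕ) := by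
  rw [node, lvl_vertex, depth_treeVertex]

lemma node_injective (n : ℕ) : Function.Injective (node X (n := n)) := by
  intro x y h
  have : (some ⟨n, x⟩ : Option (Σ n, X.term n)) = some ⟨n, y⟩ := (tree X).vertex_injective h
  simpa using this

lemma exists_node {n : ℕ} {y : (tree X).Space} (h : lvl y = (n + 1 : ℕ)) :
    ∃ x : X.term n, node X x = y := by
  obtain ⟨a, rfl⟩ := (tree X).exists_vertex_of_lvl h
  rw [lvl_vertex, depth_tree, Nat.cast_inj] at h
  match a, h with
  | some ⟨m, x⟩, h =>
    obtain rfl : m = n := Nat.succ_injective h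
    exact ⟨x, rfl⟩

lemma anc_node {n m : ℕ} (h : n ≤ m) (x : X.term m) :
    anc ((n + 1 : ℕ) : ℝ) (node X x) = node X (X.bond h x) := by
  induction m, h using Nat.le_induction with
  | base =>
    rw [bond_refl]
    exact anc_of_lvl_le (lvl_node X x).le
  | succ m h ih =>
    have h1 : node X (X.bond m.le_succ x) = anc ((m + 1 : ℕ) : ℝ) (node X x) := by
      have := (tree X).vertex_eq_anc (a := treeVertex X (X.bond m.le_succ x))
        (b := treeVertex X x)
        (SimpleGraph.parentGraph_adj_parent (treeDepth_parent X) (a := some ⟨m + 1, x⟩) (by simp))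
        (by rw [depth_treeVertex, depth_treeVertex])
      rwa [depth_treeVertex] at this
    have h2 := ih (X.bond m.le_succ x)
    rw [h1, anc_anc_of_le (Nat.cast_nonneg _) (by exact_mod_cast Nat.succ_le_succ h)] at h2
    rw [h2, ← bond_bond X h m.le_succ]
    rfl

/-- The member of the `n`-th set of a tower that corresponds to a point at distance `n + 1` from the
root of its tree. -/
noncomputable def ofNode {n : ℕ} (y : (sphereTower (tree X)).term (n + 1)) : X.term n :=
  (exists_node X (lvl_ofTerm y)).choose

@[simp] lemma node_ofNode {n : ℕ} (y : (sphereTower (tree X)).term (n + 1)) :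
    node X (ofNode X y) = ofTerm y :=
  (exists_node X (lvl_ofTerm y)).choose_spec

/-- A tower maps to the tower of spheres of its tree. -/
noncomputable def toSpheres : PreHom X (sphereTower (tree X)) where
  idx n := n
  app n := TypeCat.ofHom fun x => toTerm (anc (n : ℝ) (node X x))
    (lvl_anc_of_le (Nat.cast_nonneg _) (by rw [lvl_node]; exact_mod_cast n.le_succ))
  compat n n' h := by
    refine ⟨n', h.le, le_rfl, term_hom_ext fun x => ?_⟩
    change anc (n : ℝ) (node X (X.bond h.le x)) =
      anc (n : ℝ) (anc (n' : ℝ) (node X (X.bond le_rfl x)))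
    rw [bond_refl, ← anc_node, anc_anc_of_le (Nat.cast_nonneg _) (by exact_mod_cast n.le_succ),
      anc_anc_of_le (Nat.cast_nonneg _) (Nat.cast_le.2 h.le)]
    rfl

/-- The tower of spheres of the tree of a tower maps to the tower. -/
noncomputable def ofSpheres : PreHom (sphereTower (tree X)) X where
  idx n := n + 1
  app n := TypeCat.ofHom fun y => ofNode X y
  compat n n' h := by
    refine ⟨n' + 1, Nat.succ_le_succ h.le, le_rfl, ?_⟩
    refine ConcreteCategory.hom_ext _ _ fun y => node_injective X n ?_
    change node X (ofNode X ((sphereTower (tree X)).bond _ y)) =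
      node X (X.bond h.le (ofNode X ((sphereTower (tree X)).bond le_rfl y)))
    rw [bond_refl, ← anc_node, node_ofNode, ofTerm_bond]
    exact congrArg _ (node_ofNode X y).symm

/-- A tower is isomorphic to the tower of spheres of its tree. -/
noncomputable def spheresTreeIso : sphereTower (tree X) ≅ X where
  hom := (⟦ofSpheres X⟧ : _root_.Quotient (PreHom.setoid _ _))
  inv := (⟦toSpheres X⟧ : _root_.Quotient (PreHom.setoid _ _))
  hom_inv_id := Quotient.sound fun n => by
    refine ⟨n + 1, le_rfl, n.le_succ, term_hom_ext fun y => ?_⟩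
    change anc (n : ℝ) (node X (ofNode X ((sphereTower (tree X)).bond le_rfl y))) =
      anc (n : ℝ) (ofTerm y)
    rw [node_ofNode, bond_refl]
    rfl
  inv_hom_id := Quotient.sound fun n => by
    refine ⟨n + 1, le_rfl, n.le_succ, ?_⟩
    refine ConcreteCategory.hom_ext _ _ fun x => node_injective X n ?_
    change node X (ofNode X (toTerm (anc ((n + 1 : ℕ) : ℝ) (node X (X.bond le_rfl x))) _)) =
      node X (X.bond n.le_succ x)
    refine (node_ofNode X _).trans ?_
    change anc ((n + 1 : ℕ) : ℝ) (node X (X.bond (le_refl (n + 1)) x)) = _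
    rw [bond_refl, ← anc_node]
    rfl

end Tower

instance : RootedSimplicialTree.sphereFunctor.{u}.EssSurj where
  mem_essImage X := ⟨Tower.tree X, ⟨Tower.spheresTreeIso X⟩⟩

instance : RootedSimplicialTree.sphereFunctor.{u}.IsEquivalence where

theorem corollary6p3 : Nonempty (TowerSet.{u} ≌ RootedSimplicialTree.{u}) :=
  ⟨RootedSimplicialTree.sphereFunctor.asEquivalence.symm⟩
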